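/- Let $k$ be a field and let $A=kQ/I$ be a gentle algebra with marked ribbon surface $(\mathcal S,\mathcal M,\Gamma)$: $\mathcal S$ is an oriented connected surface with boundary, $\mathcal M\subset\partial\mathcal S$ a finite set of marked points, $\Gamma$ a finite set of arcs with endpoints in $\mathcal M$ and pairwise disjoint interiors which cuts $\mathcal S$ into elementary polygons, each with exactly one side not in $\Gamma$ (a boundary segment between marked points, or an unmarked boundary component). The vertices of $Q$ are the arcs; there is an arrow $u\to v$ for each corner of an elementary polygon at which $v$ follows $u$ counterclockwise around the common marked point; and $I$ is generated by the products $\alpha\beta$ of arrows given by successive corners of one elementary polygon. Modules are right modules, and paths are composed from left to right. For an elementary polygon $\Delta$ let $\mathfrak C(\Delta)$ be the number of sides of $\Delta$ that belong to $\Gamma$, and $\mathfrak C(\Delta)=\infty$ if an unmarked boundary component is a side of $\Delta$. A permissible curve $c$ is a curve whose segment between any two consecutive crossings with $\Gamma$ cuts off one corner of an elementary polygon; $M(c)$ denotes the string module whose string is read off from these corners. Let $\gamma\in\Gamma$ have ends at $p$ and $q$ (possibly $p=q$). Let $\gamma^0_1,\dots,\gamma^0_i=\gamma$ $(i\ge1)$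 be all the arcs (arc ends) at $p$ up to and including the given end of $\gamma$, in counterclockwise order around $p$, starting from the boundary, and let $\tilde\gamma^0_1,\dots,\tilde\gamma^0_j=\gamma$ $(j\ge1)$ be the analogous sequence at $q$ for the other end of $\gamma$. Let $c_{\mathrm{inj}}^{\gamma}$ be the permissible curve that consecutively crosses $\gamma^0_1,\dots,\gamma^0_{i-1},\gamma,\tilde\gamma^0_{j-1},\dots,\tilde\gamma^0_1$ (turning around $p$, and then around $q$), and let $M=M(c_{\mathrm{inj}}^{\gamma})$ be the corresponding indecomposable injective $A$-module. Let $\gamma^1_1$ be the arc, if there is one, which immediately follows $\gamma^0_1$ in the counterclockwise order at the end of $\gamma^0_1$ opposite to the one at $p$ in the list above. Let $\Delta_{\gamma^0_1}$ be the elementary polygon in which $c_{\mathrm{inj}}^\gamma$ starts (if $\gamma^1_1$ exists, it is the elementary polygon having the corner between $\gamma^0_1$ and $\gamma^1_1$). Define $\tilde\gamma^1_1$ and $\Delta_{\tilde\gamma^0_1}$ in the same way from $\tilde\gamma^0_1$, $q$ and the other end of the curve. Then: (a) If $M$ is not projective, then $$\mathrm{proj.dim}\,M=\max\{1,\ \mathfrak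 C(\Delta_{\gamma^0_1})-1,\ \mathfrak C(\Delta_{\tilde\gamma^0_1})-1\}.$$ (b) If $\gamma^1_1$ and $\tilde\gamma^1_1$ both exist, then $\mathrm{proj.dim}\,M=\max\{\mathfrak C(\Delta_{\gamma^0_1}),\mathfrak C(\Delta_{\tilde\gamma^0_1})\}-1$. (c) If neither $\gamma^1_1$ nor $\tilde\gamma^1_1$ exists and $M$ is not projective, then $\mathrm{proj.dim}\,M=1$. (d) $M$ is projective (so that $\mathrm{proj.dim}\,M=0$) if and only if neither $\gamma^1_1$ nor $\tilde\gamma^1_1$ exists and, in addition, $i=1$ or $j=1$. -/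

import Mathlib

open CategoryTheory

universe u

/-! ### Bound quivers with quadratic monomial relations, and gentle algebras -/

/-- A quiver with vertex set `V` and arrow set `E`, together with a set of paths `αβ` of length two
(first `α`, then `β`): the pairs with `rel α β`. -/
structure BoundQuiver (V E : Type*) where
  src : E → V
  tgt : E → V
  rel : E → E → Prop
  rel_comp : ∀ α β, rel α β → tgt α = src β

namespace BoundQuiver

variable {V E : Type*} (Q : BoundQuiver V E)

/-- `αβ` is a path of length two that is not a relation. -/
def Permitted (α β : E) : Prop := Q.tgt α = Q.src β ∧ ¬ Q.rel α β

/-- The pair `(Q, I)` is gentle, where `I` is generated by the relations `rel` of length two. -/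
structure IsGentle : Prop where
  src_le_two : ∀ v, {α | Q.src α = v}.encard ≤ 2
  tgt_le_two : ∀ v, {α | Q.tgt α = v}.encard ≤ 2
  permitted_left : ∀ β, {α | Q.Permitted α β}.encard ≤ 1
  permitted_right : ∀ β, {α | Q.Permitted β α}.encard ≤ 1
  rel_left : ∀ β, {α | Q.rel α β}.encard ≤ 1
  rel_right : ∀ β, {α | Q.rel β α}.encard ≤ 1
  /-- Long paths that end with `β` contain a relation. -/
  bound_left : ∀ β, ∃ n : ℕ, ∀ l : List E, l.length = n → ¬ (l ++ [β]).IsChain Q.Permitted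
  /-- Long paths that start with `β` contain a relation. -/
  bound_right : ∀ β, ∃ n : ℕ, ∀ l : List E, l.length = n → ¬ (β :: l).IsChain Q.Permitted

/-- An isomorphism of bound quivers. -/
structure Iso {V E V' E' : Type*} (Q : BoundQuiver V E) (Q' : BoundQuiver V' E') where
  vertex : V ≃ V'
  arrow : E ≃ E'
  src_arrow : ∀ α, Q'.src (arrow α) = vertex (Q.src α)
  tgt_arrow : ∀ α, Q'.tgt (arrow α) = vertex (Q.tgt α)
  rel_arrow : ∀ α β, Q'.rel (arrow α) (arrow β) ↔ Q.rel α β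

section Algebra

variable (k : Type*) [CommRing k] [Fintype V]

/-- The trivial path at `v`, as a generator. -/
def idem (v : V) : FreeAlgebra k (V ⊕ E) := FreeAlgebra.ι k (Sum.inl v)

/-- The arrow `α`, as a generator. -/
def arr (α : E) : FreeAlgebra k (V ⊕ E) := FreeAlgebra.ι k (Sum.inr α)

/-- The defining relations of `kQ / I`: the first five kinds present the path algebra `kQ`
(paths are composed from left to right), the last one generates `I`. -/
inductive AlgebraRel : FreeAlgebra k (V ⊕ E) → FreeAlgebra k (V ⊕ E) → Prop
  | idem_mul_self (v : V) : AlgebraRel (idem k v * idem k v) (idem k v)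
  | idem_mul_ne (v w : V) (h : v ≠ w) : AlgebraRel (idem k v * idem k w) 0
  | sum_idem : AlgebraRel (∑ v : V, idem k v) 1
  | src_mul (α : E) : AlgebraRel (idem k (Q.src α) * arr k α) (arr k α)
  | mul_tgt (α : E) : AlgebraRel (arr k α * idem k (Q.tgt α)) (arr k α)
  | rel_mul (α β : E) (h : Q.rel α β) : AlgebraRel (arr k α * arr k β) 0

/-- The algebra `A = kQ / I`. -/
abbrev QuotAlgebra : Type _ := RingQuot (Q.AlgebraRel k)

end Algebra

end BoundQuiver

/-! ### Marked ribbon surfaces -/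

/-- A marked ribbon surface `(𝒮, ℳ, Γ)`, given by its marked ribbon graph.

`P` is the set `ℳ` of marked points and `Γ` is the full formal arc system. Every arc `γ` has the two
ends `(γ, false)` and `(γ, true)` (its germs at `γ(0⁺)` and at `γ(1⁻)`), and `pt` sends an end to the
marked point in which it lies. The permutation `rot` turns counterclockwise around every marked
point from an end to the following one, and `last p` is the end after which one meets the
boundary of the surface, so that the ends at `p` are, in the counterclockwise order,
`rot (last p), rot (rot (last p)), …, last p`. -/
structure MarkedRibbonSurface (Γ P : Type*) where
  pt : Γ × Bool → P
  rot : Equiv.Perm (Γ × Bool)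
  pt_eq_iff : ∀ x y, pt x = pt y ↔ rot.SameCycle x y
  last : P → Γ × Bool
  pt_last : ∀ p, pt (last p) = p
  connected : ∀ a b : Γ, Relation.EqvGen (fun a b => ∃ s t, pt (a, s) = pt (b, t)) a b

/-- The other end of the same arc. -/
def otherEnd {Γ : Type*} (x : Γ × Bool) : Γ × Bool := (x.1, !x.2)

theorem otherEnd_otherEnd {Γ : Type*} (x : Γ × Bool) : otherEnd (otherEnd x) = x := by
  simp [otherEnd]

theorem otherEnd_ne {Γ : Type*} (x : Γ × Bool) : otherEnd x ≠ x := by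
  intro h
  have := congrArg Prod.snd h
  simp [otherEnd] at this

namespace MarkedRibbonSurface

variable {Γ P : Type*} (S : MarkedRibbonSurface Γ P)

/-- The end `x` is the last one, counterclockwise, at its marked point. -/
def IsLast (x : Γ × Bool) : Prop := x = S.last (S.pt x)

/-- The end `y` follows the end `x` immediately in the counterclockwise order around their common
marked point, inside the surface. -/
def Next (x y : Γ × Bool) : Prop := ¬ S.IsLast x ∧ S.rot x = y

/-- The corners of the elementary polygons between two consecutive arcs; the corner between `x` and
`rot x` is indexed by `x`. -/
abbrev Corner : Type _ := {x : Γ × Bool // ¬ S.IsLast x}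

/-- The bound quiver `(Q_𝒮, I_𝒮)`: vertices are the arcs, there is one arrow `u → v` for every corner of
an elementary polygon at which `v` follows `u` counterclockwise, and `αβ` is a relation when `α` and
`β` are successive corners of the same elementary polygon, that is, sit at the two
ends of the side `t(α) = s(β)` of that polygon. -/
def boundQuiver : BoundQuiver Γ S.Corner where
  src x := x.1.1
  tgt x := (S.rot x.1).1
  rel x y := y.1 = otherEnd (S.rot x.1)
  rel_comp x y h := by simp [h, otherEnd]

/-- The pairs (arc, side of the arc) are indexed by the ends: an end `x` stands for the side of its
arc that is met when turning counterclockwise around `pt x`. Such a side `x` of an elementary polygon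
and the side `y` of an elementary polygon are consecutive sides of the same polygon when the corner
between them is the one after `x`. -/
def ConsecutiveSides (x y : Γ × Bool) : Prop := S.Next x (otherEnd y)

/-- The elementary polygons: a polygon is the class of its sides belonging to `Γ`. -/
def polygonSetoid : Setoid (Γ × Bool) := Relation.EqvGen.setoid S.ConsecutiveSides

def Polygon : Type _ := Quotient S.polygonSetoid

/-- The elementary polygon that lies next to the end `x` in the counterclockwise direction. -/
def polygonAt (x : Γ × Bool) : S.Polygon := Quotient.mk S.polygonSetoid x

/-- The sides of `Δ` that belong to `Γ` (an arc with `Δ` on both sides counts twice). -/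
def sides (Δ : S.Polygon) : Set (Γ × Bool) := {x | S.polygonAt x = Δ}

open Classical in
/-- The consecutive arcs number `ℭ(Δ)`. The remaining side of `Δ` is a boundary segment
between marked points exactly when one of the sides in `Γ` is followed by the boundary;
otherwise the sides in `Γ` close up around an unmarked boundary component. -/
noncomputable def consecutiveArcs (Δ : S.Polygon) : ℕ∞ :=
  if ∃ x ∈ S.sides Δ, S.IsLast x then (S.sides Δ).encard else ⊤

/-! ### Permissible curves and their string modules -/

/-- A non-trivial permissible curve, up to equivalence, that is, given by its crossings with `Γ`.

The curve crosses `len + 1` arcs. The crossing number `i` goes over the arc of the end `cross i`, in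
the direction which is counterclockwise around `pt (cross i)`. The segment between two consecutive
crossings cuts off a corner of an elementary polygon: if `ccw i` holds then it turns
counterclockwise around the common marked point of the two arcs (which is on its left), otherwise
it turns clockwise around it (and the point is on its right). -/
structure PermissibleCurve where
  len : ℕ
  cross : Fin (len + 1) → Γ × Bool
  ccw : Fin len → Prop
  step_ccw : ∀ i, ccw i → S.Next (cross i.castSucc) (cross i.succ)
  step_cw : ∀ i, ¬ ccw i → S.Next (otherEnd (cross i.succ)) (otherEnd (cross i.castSucc))

namespace PermissibleCurve

variable {S} (c : S.PermissibleCurve)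

/-- `c` is an injective permissible curve `c_inj^γ`, where `γ` is crossed at the place `i`:
up to `γ` the curve turns counterclockwise, around an endpoint `p` of `γ` on its left, and from `γ` on
it turns clockwise, around the other endpoint `q` on its right; moreover at `p` no arc comes before
the first arc crossed, and at `q` no arc comes before the last arc crossed (in the counterclockwise
order). -/
structure IsInjective (γ : Γ) (i : Fin (c.len + 1)) : Prop where
  arc_eq : (c.cross i).1 = γ
  left : ∀ t : Fin c.len, t.val < i.val → c.ccw t
  right : ∀ t : Fin c.len, i.val ≤ t.val → ¬ c.ccw t
  left_max : ∀ z, ¬ S.Next z (c.cross 0)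
  right_max : ∀ z, ¬ S.Next z (otherEnd (c.cross (Fin.last c.len)))

/-- The end, opposite to `p`, of the first arc `γ⁰₁` crossed by `c`. -/
def firstEnd : Γ × Bool := otherEnd (c.cross 0)

/-- The end, opposite to `q`, of the last arc `γ̃⁰₁` crossed by `c`. -/
def lastEnd : Γ × Bool := c.cross (Fin.last c.len)

/-- The next arc `γ¹₁` exists: some arc follows `γ⁰₁` counterclockwise around the endpoint of `γ⁰₁`
opposite to `p`. -/
def FirstExists : Prop := ∃ y, S.Next c.firstEnd y

/-- The next arc `γ̃¹₁` exists: some arc follows `γ̃⁰₁` counterclockwise around the endpoint of `γ̃⁰₁`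
opposite to `q`. -/
def LastExists : Prop := ∃ y, S.Next c.lastEnd y

/-- The elementary polygon in which `c` starts; it contains the corner from `γ⁰₁` to `γ¹₁` when `γ¹₁`
exists. -/
def firstPolygon : S.Polygon := S.polygonAt c.firstEnd

/-- The elementary polygon in which `c` ends; it contains the corner from `γ̃⁰₁` to `γ̃¹₁` when `γ̃¹₁`
exists. -/
def lastPolygon : S.Polygon := S.polygonAt c.lastEnd

/-- In the string of `c`, the corner `x` is an arrow from the place `i` to the adjacent place `j`. -/
def Moves (x : Γ × Bool) (i j : Fin (c.len + 1)) : Prop :=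
  (∃ t, c.ccw t ∧ i = t.castSucc ∧ j = t.succ ∧ x = c.cross i) ∨
  (∃ t, ¬ c.ccw t ∧ i = t.succ ∧ j = t.castSucc ∧ x = otherEnd (c.cross i))

theorem Moves.next {x : Γ × Bool} {i j : Fin (c.len + 1)} (h : c.Moves x i j) :
    x.1 = (c.cross i).1 ∧ (S.rot x).1 = (c.cross j).1 := by
  rcases h with ⟨t, ht, rfl, rfl, rfl⟩ | ⟨t, ht, rfl, rfl, rfl⟩
  · exact ⟨rfl, by rw [(c.step_ccw t ht).2]⟩
  · exact ⟨rfl, by rw [(c.step_cw t ht).2]; rfl⟩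

theorem Moves.not_rel {x : Γ × Bool} {i j l : Fin (c.len + 1)} (h : c.Moves x i j)
    (h' : c.Moves (otherEnd (S.rot x)) j l) : False := by
  rcases h with ⟨t, ht, rfl, rfl, rfl⟩ | ⟨t, ht, rfl, rfl, rfl⟩
  · rw [(c.step_ccw t ht).2] at h'
    rcases h' with ⟨t', ht', e, -, e'⟩ | ⟨t', ht', e, -, e'⟩
    · exact otherEnd_ne _ e'
    · exact ht' (Fin.succ_injective _ e ▸ ht)
  · rw [(c.step_cw t ht).2, otherEnd_otherEnd] at h'
    rcases h' with ⟨t', ht', e, -, e'⟩ | ⟨t', ht', e, -, e'⟩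
    · exact ht (Fin.castSucc_injective _ e ▸ ht')
    · exact otherEnd_ne _ e'.symm

section Module

variable {V E : Type*} {Q : BoundQuiver V E} (k : Type*) [CommRing k] [Fintype V]
  (φ : Q.Iso S.boundQuiver)

open Classical in
/-- The matrix of a generator of `kQ / I` on the string module. -/
noncomputable def genMatrix : V ⊕ E → Matrix (Fin (c.len + 1)) (Fin (c.len + 1)) k
  | Sum.inl v => Matrix.diagonal fun i => if (c.cross i).1 = φ.vertex v then 1 else 0
  | Sum.inr α => Matrix.of fun i j => if c.Moves (φ.arrow α).1 i j then 1 else 0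

theorem genMatrix_rel ⦃a b : FreeAlgebra k (V ⊕ E)⦄ (h : Q.AlgebraRel k a b) :
    FreeAlgebra.lift k (c.genMatrix k φ) a = FreeAlgebra.lift k (c.genMatrix k φ) b := by
  classical
  induction h with
  | idem_mul_self v =>
    simp only [BoundQuiver.idem, genMatrix, map_mul, FreeAlgebra.lift_ι_apply,
      Matrix.diagonal_mul_diagonal]
    congr 1
    ext i
    split_ifs <;> simp
  | idem_mul_ne v w h =>
    simp only [BoundQuiver.idem, genMatrix, map_mul, FreeAlgebra.lift_ι_apply, map_zero,
      Matrix.diagonal_mul_diagonal]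
    ext i j
    by_cases hij : i = j
    · subst hij
      by_cases h1 : (c.cross i).1 = φ.vertex v
      · have : (c.cross i).1 ≠ φ.vertex w := fun h2 => h (φ.vertex.injective (h1.symm.trans h2))
        simp [this]
      · simp [h1]
    · simp [hij]
  | sum_idem =>
    simp only [BoundQuiver.idem, genMatrix, map_sum, FreeAlgebra.lift_ι_apply, map_one]
    ext i j
    rw [Matrix.sum_apply]
    by_cases hij : i = j
    · subst hij
      simp only [Matrix.diagonal_apply_eq, Matrix.one_apply_eq]
      rw [Finset.sum_eq_single (φ.vertex.symm (c.cross i).1)]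
      · simp
      · intro v _ hv
        rw [if_neg]
        intro h
        exact hv (by simp [h])
      · simp
    · simp [hij]
  | src_mul α =>
    simp only [BoundQuiver.idem, BoundQuiver.arr, genMatrix, map_mul, FreeAlgebra.lift_ι_apply]
    ext i j
    rw [Matrix.diagonal_mul]
    simp only [Matrix.of_apply]
    by_cases h : c.Moves (φ.arrow α).1 i j
    · have h1 := (Moves.next c h).1
      have h2 := φ.src_arrow α
      rw [if_pos h, if_pos (h1.symm.trans h2), one_mul]
    · simp [h]
  | mul_tgt α =>
    simp only [BoundQuiver.idem, BoundQuiver.arr, genMatrix, map_mul, FreeAlgebra.lift_ι_apply]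
    ext i j
    rw [Matrix.mul_diagonal]
    simp only [Matrix.of_apply]
    by_cases h : c.Moves (φ.arrow α).1 i j
    · have h1 := (Moves.next c h).2
      have h2 := φ.tgt_arrow α
      rw [if_pos h, if_pos (h1.symm.trans h2), one_mul]
    · simp [h]
  | rel_mul α β h =>
    simp only [BoundQuiver.arr, genMatrix, map_mul, FreeAlgebra.lift_ι_apply, map_zero]
    ext i l
    rw [Matrix.mul_apply]
    refine Finset.sum_eq_zero fun j _ => ?_
    simp only [Matrix.of_apply]
    by_cases h1 : c.Moves (φ.arrow α).1 i j
    · have h2 : ¬ c.Moves (φ.arrow β).1 j l := by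
        have h3 : (φ.arrow β).1 = otherEnd (S.rot (φ.arrow α).1) := (φ.rel_arrow α β).2 h
        rw [h3]
        exact fun h4 => Moves.not_rel c h1 h4
      rw [if_neg h2, mul_zero]
    · rw [if_neg h1, zero_mul]

/-- The string representation of `kQ / I` given by `c`. -/
noncomputable def stringRep :
    Q.QuotAlgebra k →ₐ[k] Matrix (Fin (c.len + 1)) (Fin (c.len + 1)) k :=
  RingQuot.liftAlgHom k ⟨FreeAlgebra.lift k (c.genMatrix k φ), c.genMatrix_rel k φ⟩

/-- The right action of `kQ / I` on row vectors. -/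
@[reducible] noncomputable def stringAction :
    Module (Q.QuotAlgebra k)ᵐᵒᵖ (Fin (c.len + 1) → k) where
  smul a v := Matrix.vecMul v (c.stringRep k φ a.unop)
  one_smul v := by
    change Matrix.vecMul v (c.stringRep k φ 1) = v
    rw [map_one, Matrix.vecMul_one]
  mul_smul a b v := by
    change Matrix.vecMul v (c.stringRep k φ (b.unop * a.unop)) =
      Matrix.vecMul (Matrix.vecMul v (c.stringRep k φ b.unop)) (c.stringRep k φ a.unop)
    rw [map_mul, Matrix.vecMul_vecMul]
  smul_zero a := Matrix.zero_vecMul _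
  smul_add a v w := Matrix.add_vecMul _ v w
  add_smul a b v := by
    change Matrix.vecMul v (c.stringRep k φ (a.unop + b.unop)) = _
    rw [map_add, Matrix.vecMul_add]
    rfl
  zero_smul v := by
    change Matrix.vecMul v (c.stringRep k φ 0) = 0
    rw [map_zero, Matrix.vecMul_zero]

end Module

/-- The string module `M(c)`, a right module over `A = kQ / I`: it has a basis indexed by the
crossings of `c`, and an arrow of `Q` sends a basis vector to the adjacent one when it is the
corner cut off by the segment of `c` between them. -/
noncomputable def stringModule {V E k Γ P : Type u} [CommRing k] [Fintype V] {Q : BoundQuiver V E}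
    {S : MarkedRibbonSurface Γ P} (φ : Q.Iso S.boundQuiver) (c : S.PermissibleCurve) :
    ModuleCat.{u} (Q.QuotAlgebra k)ᵐᵒᵖ :=
  letI := c.stringAction k φ
  ModuleCat.of (Q.QuotAlgebra k)ᵐᵒᵖ (Fin (c.len + 1) → k)

end PermissibleCurve

end MarkedRibbonSurface

/-! Write U(x) for the uniserial module whose basis consists of the end x and the ends after it at
the same marked point (`uniserial`), and P(x) for the indecomposable projective at the arc of x.
P(x) is the fibre product of U(x) and U(x') over their common top, where x' is the other end of that
arc (`projectiveAt`). All these modules live in a concrete space of functions on the ends, so no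
basis of kQ/I is ever needed. P(x) is projective because it is a direct summand of the regular
module: an explicit combination of paths turning around the two marked points defines a section
(`projective_projectiveAt`).

Two short exact sequences carry the proof.

The kernel of P(x) → U(x) is zero if x' is the last end at its marked point, and is U(y) if y is the
end following x'. Passing from x to y moves along one side of an elementary polygon. Repeated
syzygies of U(x) therefore walk along the sides of the polygon at x' until the boundary is met, and
the projective dimension is the number m of steps (`hasProjectiveDimensionLT_uniserial`). When x is
the first end at its marked point, the walk starts at the first side and visits every side once. The
polygon then has m + 1 sides in Γ, that is, m = ℭ - 1 (`consecutiveArcs_polygonAt`).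

The injective module M is the sum of two uniserial modules sharing their socle, which gives 0 → P(γ)
→ U(γ⁰₁) ⊕ U(γ̃⁰₁) → M → 0 (`shortExact_presentation`). As P(γ) is projective, a non-projective M
has dimension max(1, m, n), with m and n the dimensions of the two uniserial summands. M is
projective exactly when m = n = 0 and the sequence splits. If γ lies strictly inside the string,
P(γ) is contained in the radical of the middle term and no splitting exists
(`eq_zero_or_eq_last_of_projective`). If γ is the first or last crossing and m = n = 0, then P(γ)
maps isomorphically onto one summand (`projective_stringModule`). -/

set_option linter.unusedSectionVars false

/-! ### Generators of kQ/I and their action on right modules -/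

namespace BoundQuiver

variable {V E : Type*} (Q : BoundQuiver V E) (k : Type*) [CommRing k] [Fintype V]

/-- The trivial path at `v` in `kQ / I`. -/
noncomputable def vertexElt (v : V) : Q.QuotAlgebra k :=
  RingQuot.mkAlgHom k (Q.AlgebraRel k) (idem k v)

/-- The arrow `α` in `kQ / I`. -/
noncomputable def arrowElt (α : E) : Q.QuotAlgebra k :=
  RingQuot.mkAlgHom k (Q.AlgebraRel k) (arr k α)

variable {Q k}

theorem vertexElt_mul_self (v : V) :
    Q.vertexElt k v * Q.vertexElt k v = Q.vertexElt k v := by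
  rw [vertexElt, ← map_mul]
  exact RingQuot.mkAlgHom_rel k (.idem_mul_self v)

theorem vertexElt_mul_of_ne {v w : V} (h : v ≠ w) :
    Q.vertexElt k v * Q.vertexElt k w = 0 := by
  rw [vertexElt, vertexElt, ← map_mul, RingQuot.mkAlgHom_rel k (.idem_mul_ne v w h), map_zero]

theorem vertexElt_src_mul (α : E) :
    Q.vertexElt k (Q.src α) * Q.arrowElt k α = Q.arrowElt k α := by
  rw [vertexElt, arrowElt, ← map_mul]
  exact RingQuot.mkAlgHom_rel k (.src_mul α)

theorem arrowElt_mul_vertexElt_tgt (α : E) :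
    Q.arrowElt k α * Q.vertexElt k (Q.tgt α) = Q.arrowElt k α := by
  rw [vertexElt, arrowElt, ← map_mul]
  exact RingQuot.mkAlgHom_rel k (.mul_tgt α)

theorem arrowElt_mul_arrowElt_of_rel {α β : E} (h : Q.rel α β) :
    Q.arrowElt k α * Q.arrowElt k β = 0 := by
  rw [arrowElt, arrowElt, ← map_mul, RingQuot.mkAlgHom_rel k (.rel_mul α β h), map_zero]

theorem vertexElt_mul_arrowElt_of_ne {v : V} {α : E} (h : Q.src α ≠ v) :
    Q.vertexElt k v * Q.arrowElt k α = 0 := by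
  rw [← vertexElt_src_mul, ← mul_assoc, vertexElt_mul_of_ne h.symm, zero_mul]

theorem arrowElt_mul_vertexElt_of_ne {v : V} {α : E} (h : Q.tgt α ≠ v) :
    Q.arrowElt k α * Q.vertexElt k v = 0 := by
  rw [← arrowElt_mul_vertexElt_tgt, mul_assoc, vertexElt_mul_of_ne h, mul_zero]

theorem arrowElt_mul_arrowElt_of_ne {α β : E} (h : Q.tgt α ≠ Q.src β) :
    Q.arrowElt k α * Q.arrowElt k β = 0 := by
  rw [← vertexElt_src_mul β, ← mul_assoc, arrowElt_mul_vertexElt_of_ne h, zero_mul]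

@[elab_as_elim]
theorem quotAlgebra_induction {p : Q.QuotAlgebra k → Prop}
    (scalar : ∀ r, p (algebraMap k _ r)) (vertex : ∀ v, p (Q.vertexElt k v))
    (arrow : ∀ α, p (Q.arrowElt k α)) (add : ∀ a b, p a → p b → p (a + b))
    (mul : ∀ a b, p a → p b → p (a * b)) (a : Q.QuotAlgebra k) : p a := by
  obtain ⟨a, rfl⟩ := RingQuot.mkAlgHom_surjective k (Q.AlgebraRel k) a
  induction a using FreeAlgebra.induction with
  | grade0 r => simpa using scalar r
  | grade1 x => exact x.casesOn vertex arrow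
  | mul a b ha hb => rw [map_mul]; exact mul _ _ ha hb
  | add a b ha hb => rw [map_add]; exact add _ _ ha hb

open MulOpposite

section Modules

variable {N N' : Type*} [AddCommGroup N] [Module (Q.QuotAlgebra k)ᵐᵒᵖ N]
  [AddCommGroup N'] [Module (Q.QuotAlgebra k)ᵐᵒᵖ N']

/-- An additive map of right modules is linear if it commutes with scalars, trivial paths and
arrows. -/
def linearMapOfGenerators (f : N →+ N')
    (scalar : ∀ (r : k) n, f (op (algebraMap k (Q.QuotAlgebra k) r) • n) =
      op (algebraMap k (Q.QuotAlgebra k) r) • f n)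
    (vertex : ∀ v n, f (op (Q.vertexElt k v) • n) = op (Q.vertexElt k v) • f n)
    (arrow : ∀ α n, f (op (Q.arrowElt k α) • n) = op (Q.arrowElt k α) • f n) :
    N →ₗ[(Q.QuotAlgebra k)ᵐᵒᵖ] N' where
  toFun := f
  map_add' := map_add f
  map_smul' r n := by
    change f (r • n) = r • f n
    obtain ⟨a, rfl⟩ := op_surjective r
    induction a using quotAlgebra_induction generalizing n with
    | scalar r => exact scalar r n
    | vertex v => exact vertex v n
    | arrow α => exact arrow α n
    | add a b ha hb =>
      change f ((op a + op b) • n) = (op a + op b) • f n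
      simp only [add_smul, map_add, ha, hb]
    | mul a b ha hb => simp only [op_mul, mul_smul, ha, hb]

/-- An additive subgroup of a right module is a submodule if it is closed under scalars, trivial
paths and arrows. -/
def submoduleOfGenerators (H : AddSubgroup N)
    (scalar : ∀ (r : k), ∀ n ∈ H, op (algebraMap k (Q.QuotAlgebra k) r) • n ∈ H)
    (vertex : ∀ v, ∀ n ∈ H, op (Q.vertexElt k v) • n ∈ H)
    (arrow : ∀ α, ∀ n ∈ H, op (Q.arrowElt k α) • n ∈ H) :
    Submodule (Q.QuotAlgebra k)ᵐᵒᵖ N where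
  __ := H
  smul_mem' r n hn := by
    change r • n ∈ H
    change n ∈ H at hn
    obtain ⟨a, rfl⟩ := op_surjective r
    induction a using quotAlgebra_induction generalizing n with
    | scalar r => exact scalar r n hn
    | vertex v => exact vertex v n hn
    | arrow α => exact arrow α n hn
    | add a b ha hb =>
      change (op a + op b) • n ∈ H
      rw [add_smul]
      exact add_mem (ha n hn) (hb n hn)
    | mul a b ha hb => rw [op_mul, mul_smul]; exact hb _ (ha n hn)

end Modules

end BoundQuiver

/-! ### The order of the ends at a marked point, and the module of functions on the ends -/

namespace MarkedRibbonSurface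

open BoundQuiver MulOpposite

variable {Γ P : Type*} (S : MarkedRibbonSurface Γ P)

theorem exists_isLast_iterate [Finite Γ] (x : Γ × Bool) : ∃ n : ℕ, S.IsLast ((S.rot)^[n] x) := by
  have h : S.rot.SameCycle x (S.last (S.pt x)) := (S.pt_eq_iff _ _).1 (S.pt_last _).symm
  obtain ⟨n, -, hn⟩ := h.exists_pow_eq'
  refine ⟨n, ?_⟩
  rw [← Equiv.Perm.coe_pow, hn, IsLast, S.pt_last]

open Classical in
/-- The number of ends that come after `x`, counterclockwise, at the marked point of `x`. -/
noncomputable def depth [Finite Γ] (x : Γ × Bool) : ℕ := Nat.find (S.exists_isLast_iterate x)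

variable {S}

/-- `rot` is cyclic, but `Next` stops at the boundary. The depth turns this into a strictly
decreasing measure, which later rules out every return to an earlier end. -/
theorem Next.depth_eq [Finite Γ] {x y : Γ × Bool} (h : S.Next x y) :
    S.depth x = S.depth y + 1 := by
  classical
  obtain ⟨h, rfl⟩ := h
  exact Nat.find_comp_succ (S.exists_isLast_iterate x) (S.exists_isLast_iterate (S.rot x)) h

variable (S) in
/-- The end `y` is `x`, or it comes after `x`, counterclockwise, at the same marked point. -/
def After (x y : Γ × Bool) : Prop := Relation.ReflTransGen S.Next x y

theorem After.depth_le [Finite Γ] {x y : Γ × Bool} (h : S.After x y) :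
    S.depth y ≤ S.depth x := by
  induction h with
  | refl => rfl
  | tail _ h ih => have := h.depth_eq; omega

theorem Next.not_after [Finite Γ] {x y : Γ × Bool} (h : S.Next x y) : ¬ S.After y x := by
  intro h'
  have := h'.depth_le
  have := h.depth_eq
  omega

theorem Next.injective {x x' y : Γ × Bool} (h : S.Next x y) (h' : S.Next x' y) : x = x' :=
  S.rot.injective (h.2.trans h'.2.symm)

theorem IsLast.eq_of_after {x y : Γ × Bool} (hx : S.IsLast x) (h : S.After x y) : y = x := by
  rcases h.cases_head with h | ⟨z, h, -⟩
  · exact h.symm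
  · exact absurd hx h.1

theorem After.eq_or_next {x y z : Γ × Bool} (h : S.After x y) (hz : S.Next x z) :
    y = x ∨ S.After z y := by
  rcases h.cases_head with h | ⟨z', h, h'⟩
  · exact .inl h.symm
  · obtain rfl : z' = z := h.2.symm.trans hz.2
    exact .inr h'

section EndSpace

variable {V E : Type*} {Q : BoundQuiver V E} (k : Type*) [CommRing k] [Fintype V]

/-- The right `kQ / I`-module of functions on the set of ends: the corner `x` moves the basis
vector at `x` to the one at `S.rot x`. It is the sum of one uniserial module for each marked
point. -/
def EndSpace (_φ : Q.Iso S.boundQuiver) : Type _ := Γ × Bool → k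

variable (φ : Q.Iso S.boundQuiver)

noncomputable instance : AddCommGroup (EndSpace k φ) := inferInstanceAs (AddCommGroup (Γ × Bool → k))
noncomputable instance : Module k (EndSpace k φ) := inferInstanceAs (Module k (Γ × Bool → k))

open Classical in
/-- The action of the generators of `kQ / I` on functions on the set of ends. -/
noncomputable def genAction : V ⊕ E → Module.End k (Γ × Bool → k)
  | Sum.inl v =>
    { toFun w y := if y.1 = φ.vertex v then w y else 0
      map_add' w w' := by ext y; dsimp only [Pi.add_apply]; split_ifs <;> simp
      map_smul' r w := by ext y; simp }
  | Sum.inr α =>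
    { toFun w y := if y = S.rot (φ.arrow α).1 then w (φ.arrow α).1 else 0
      map_add' w w' := by ext y; dsimp only [Pi.add_apply]; split_ifs <;> simp
      map_smul' r w := by ext y; simp }

theorem genAction_rel ⦃a b : FreeAlgebra k (V ⊕ E)⦄ (h : Q.AlgebraRel k a b) :
    FreeAlgebra.lift k (fun g => op (genAction k φ g)) a =
      FreeAlgebra.lift k (fun g => op (genAction k φ g)) b := by
  classical
  apply unop_injective
  induction h with
  | idem_mul_self v =>
    simp only [idem, map_mul, FreeAlgebra.lift_ι_apply, ← op_mul, unop_op]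
    ext w y
    simp only [genAction, Module.End.mul_apply, LinearMap.coe_mk, AddHom.coe_mk]
    split_ifs <;> rfl
  | idem_mul_ne v w h =>
    simp only [idem, map_mul, FreeAlgebra.lift_ι_apply, ← op_mul, unop_op, map_zero, unop_zero]
    ext u y
    simp only [genAction, Module.End.mul_apply, LinearMap.coe_mk, AddHom.coe_mk]
    split_ifs with h1 h2
    · exact absurd (φ.vertex.injective (h2.symm.trans h1)) h
    · rfl
    · rfl
  | sum_idem =>
    simp only [idem, map_sum, FreeAlgebra.lift_ι_apply, map_one, Finset.unop_sum, unop_op, unop_one]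
    ext w y
    simp only [genAction, LinearMap.sum_apply, LinearMap.coe_mk, AddHom.coe_mk, Finset.sum_apply]
    rw [Finset.sum_eq_single (φ.vertex.symm y.1)]
    · simp
    · intro v _ hv
      rw [if_neg]
      intro h
      exact hv (by simp [h])
    · simp
  | src_mul α =>
    simp only [idem, arr, map_mul, FreeAlgebra.lift_ι_apply, ← op_mul, unop_op]
    ext w y
    have : (φ.arrow α).1.1 = φ.vertex (Q.src α) := φ.src_arrow α
    simp [genAction, Module.End.mul_apply, this]
  | mul_tgt α =>
    simp only [idem, arr, map_mul, FreeAlgebra.lift_ι_apply, ← op_mul, unop_op]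
    ext w y
    have : (S.rot (φ.arrow α).1).1 = φ.vertex (Q.tgt α) := φ.tgt_arrow α
    simp only [genAction, Module.End.mul_apply, LinearMap.coe_mk, AddHom.coe_mk]
    split_ifs with h1 h2 h2
    · rfl
    · rfl
    · exact absurd (by rw [h2, this]) h1
    · rfl
  | rel_mul α β h =>
    simp only [arr, map_mul, FreeAlgebra.lift_ι_apply, ← op_mul, unop_op, map_zero, unop_zero]
    ext w y
    -- After α the function is supported at the end just reached, whereas β in a relation reads the
    -- value at the opposite end of that arc.
    have h3 : (φ.arrow β).1 = otherEnd (S.rot (φ.arrow α).1) := (φ.rel_arrow α β).2 h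
    simp [genAction, Module.End.mul_apply, h3, otherEnd_ne]

/-- The action of `kQ / I` on functions on the set of ends. -/
noncomputable def endRep : Q.QuotAlgebra k →ₐ[k] (Module.End k (Γ × Bool → k))ᵐᵒᵖ :=
  RingQuot.liftAlgHom k ⟨FreeAlgebra.lift k fun g => op (genAction k φ g), genAction_rel k φ⟩

noncomputable instance : Module (Q.QuotAlgebra k)ᵐᵒᵖ (EndSpace k φ) where
  smul a w := (endRep k φ a.unop).unop w
  one_smul w := by
    change (endRep k φ 1).unop w = w
    rw [map_one]; rfl
  mul_smul a b w := by
    change (endRep k φ (b.unop * a.unop)).unop w = _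
    rw [map_mul]; rfl
  smul_zero a := map_zero (endRep k φ a.unop).unop
  smul_add a := map_add (endRep k φ a.unop).unop
  add_smul a b w := by
    change (endRep k φ (a.unop + b.unop)).unop w = _
    rw [map_add]; rfl
  zero_smul w := by
    change (endRep k φ 0).unop w = _
    rw [map_zero]; rfl

namespace EndSpace

variable {k φ}

instance : CoeFun (EndSpace k φ) fun _ => Γ × Bool → k := ⟨fun w => w⟩

@[ext] theorem ext {w w' : EndSpace k φ} (h : ∀ y, w y = w' y) : w = w' := funext h

@[simp] theorem add_apply (w w' : EndSpace k φ) (y : Γ × Bool) : (w + w') y = w y + w' y := rfl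
@[simp] theorem sub_apply (w w' : EndSpace k φ) (y : Γ × Bool) : (w - w') y = w y - w' y := rfl
@[simp] theorem neg_apply (w : EndSpace k φ) (y : Γ × Bool) : (-w) y = -w y := rfl
@[simp] theorem zero_apply (y : Γ × Bool) : (0 : EndSpace k φ) y = 0 := rfl

theorem scalar_smul (r : k) (w : EndSpace k φ) :
    op (algebraMap k (Q.QuotAlgebra k) r) • w = r • w := by
  change (endRep k φ (algebraMap k _ r)).unop w = _
  rw [AlgHom.commutes]; rfl

@[simp] theorem scalar_smul_apply (r : k) (w : EndSpace k φ) (y : Γ × Bool) :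
    (op (algebraMap k (Q.QuotAlgebra k) r) • w) y = r * w y := by
  rw [scalar_smul]; rfl

open Classical in
@[simp] theorem vertexElt_smul_apply (v : V) (w : EndSpace k φ) (y : Γ × Bool) :
    (op (Q.vertexElt k v) • w) y = if y.1 = φ.vertex v then w y else 0 := by
  change (endRep k φ (RingQuot.mkAlgHom k _ (FreeAlgebra.ι k (Sum.inl v)))).unop w y = _
  rw [endRep, RingQuot.liftAlgHom_mkAlgHom_apply, FreeAlgebra.lift_ι_apply]
  rfl

open Classical in
@[simp] theorem arrowElt_smul_apply (α : E) (w : EndSpace k φ) (y : Γ × Bool) :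
    (op (Q.arrowElt k α) • w) y =
      if y = S.rot (φ.arrow α).1 then w (φ.arrow α).1 else 0 := by
  change (endRep k φ (RingQuot.mkAlgHom k _ (FreeAlgebra.ι k (Sum.inr α)))).unop w y = _
  rw [endRep, RingQuot.liftAlgHom_mkAlgHom_apply, FreeAlgebra.lift_ι_apply]
  rfl

end EndSpace

end EndSpace

end MarkedRibbonSurface

/-! ### Uniserial modules and indecomposable projectives -/

namespace MarkedRibbonSurface

open BoundQuiver MulOpposite

variable {Γ P : Type*} {S : MarkedRibbonSurface Γ P}
  {V E : Type*} {Q : BoundQuiver V E} {k : Type*} [CommRing k] [Fintype V]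
  {φ : Q.Iso S.boundQuiver}

namespace EndSpace

open Classical in
/-- The basis vector at the end `x`. -/
noncomputable def single (k : Type*) [CommRing k] (φ : Q.Iso S.boundQuiver) (x : Γ × Bool) :
    EndSpace k φ := Pi.single x (1 : k)

open Classical in
@[simp] theorem single_apply (x y : Γ × Bool) :
    single k φ x y = if y = x then 1 else 0 := Pi.single_apply x 1 y

open Classical in
@[simp] theorem smul_single_apply (r : k) (x y : Γ × Bool) :
    (r • single k φ x) y = if y = x then r else 0 := by
  change r • (single k φ x y) = _
  simp

/-- The arrow that corresponds to the corner after the end `x`. -/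
noncomputable def cornerArrow (φ : Q.Iso S.boundQuiver) (x : Γ × Bool) (hx : ¬ S.IsLast x) : E :=
  φ.arrow.symm ⟨x, hx⟩

@[simp] theorem arrow_cornerArrow (x : Γ × Bool) (hx : ¬ S.IsLast x) :
    (φ.arrow (cornerArrow φ x hx)).1 = x := by simp [cornerArrow]

theorem arrowElt_smul_single {x y : Γ × Bool} (h : S.Next x y) :
    op (Q.arrowElt k (cornerArrow φ x h.1)) • single k φ x = single k φ y := by
  ext z
  rw [arrowElt_smul_apply, arrow_cornerArrow, h.2, single_apply, single_apply, if_pos rfl]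

theorem arrowElt_smul_single_of_ne {x z : Γ × Bool} (hz : ¬ S.IsLast z) (h : z ≠ x) :
    op (Q.arrowElt k (cornerArrow φ z hz)) • single k φ x = 0 := by
  ext
  simp [h]

theorem mem_of_single [Finite Γ] {N : Submodule (Q.QuotAlgebra k)ᵐᵒᵖ (EndSpace k φ)}
    {w : EndSpace k φ} (h : ∀ y, w y ≠ 0 → single k φ y ∈ N) : w ∈ N := by
  classical
  have := Fintype.ofFinite Γ
  have hw : w = ∑ y, w y • single k φ y := by
    change (w : Γ × Bool → k) = ∑ y, w y • (Pi.single y (1 : k) : Γ × Bool → k)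
    ext z
    rw [Finset.sum_apply, Finset.sum_eq_single z]
    · simp
    · intro y _ hy
      simp [hy.symm]
    · simp
  rw [hw]
  refine sum_mem fun y _ => ?_
  by_cases hy : w y = 0
  · rw [hy, zero_smul]
    exact zero_mem _
  · rw [← scalar_smul]
    exact N.smul_mem _ (h y hy)

end EndSpace

open EndSpace

variable (k φ)

/-- The uniserial module of the functions supported on `x` and the ends after `x`. -/
noncomputable def uniserial (x : Γ × Bool) : Submodule (Q.QuotAlgebra k)ᵐᵒᵖ (EndSpace k φ) :=
  submoduleOfGenerators
    { carrier := {w | ∀ y, w y ≠ 0 → S.After x y}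
      zero_mem' := fun y hy => absurd rfl hy
      add_mem' := fun {w w'} hw hw' y hy => by
        by_cases h : w y = 0
        · exact hw' y fun h' => hy (by simp [h, h'])
        · exact hw y h
      neg_mem' := fun {w} hw y hy => hw y fun h => hy (by simp [h]) }
    (fun r w hw y hy => hw y fun h => hy (by simp [h]))
    (fun v w hw y hy => hw y fun h => hy (by simp [h]))
    (fun α w hw y hy => by
      classical
      rw [arrowElt_smul_apply] at hy
      split_ifs at hy with h
      · exact (hw _ hy).tail ⟨(φ.arrow α).2, h.symm⟩
      · exact absurd rfl hy)

variable {k φ}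

theorem single_mem_uniserial {x y : Γ × Bool} (h : S.After x y) :
    single k φ y ∈ uniserial k φ x := by
  intro z hz
  rw [single_apply] at hz
  split_ifs at hz with hzy
  · rwa [hzy]
  · exact absurd rfl hz

theorem apply_eq_zero_of_next [Finite Γ] {x z : Γ × Bool} (h : S.Next z x) {w : EndSpace k φ}
    (hw : w ∈ uniserial k φ x) : w z = 0 := by
  by_contra h'
  exact h.not_after (hw z h')

theorem uniserial_le_of_next {x z : Γ × Bool} (h : S.Next x z) :
    uniserial k φ z ≤ uniserial k φ x := fun _ hw y hy => .head h (hw y hy)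

/-- An arrow writes at x only what it reads at the end preceding x, and there the elements of
`uniserial k φ x` vanish. Thus radical elements have no component at the top. -/
theorem arrowElt_smul_apply_self [Finite Γ] (α : E) {x : Γ × Bool} {w : EndSpace k φ}
    (hw : w ∈ uniserial k φ x) : (op (Q.arrowElt k α) • w) x = 0 := by
  classical
  rw [arrowElt_smul_apply]
  split_ifs with h
  · exact apply_eq_zero_of_next ⟨(φ.arrow α).2, h.symm⟩ hw
  · rfl

variable (k φ)

/-- The indecomposable projective module at the arc of `x`: its two maximal uniserial quotients
start at the two ends of this arc. -/
noncomputable def projectiveAt [Finite Γ] (x : Γ × Bool) :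
    Submodule (Q.QuotAlgebra k)ᵐᵒᵖ (EndSpace k φ × EndSpace k φ) :=
  submoduleOfGenerators
    { carrier := {w | w.1 ∈ uniserial k φ x ∧ w.2 ∈ uniserial k φ (otherEnd x) ∧
        w.1 x = w.2 (otherEnd x)}
      zero_mem' := ⟨zero_mem _, zero_mem _, rfl⟩
      add_mem' := fun {w w'} hw hw' => ⟨add_mem hw.1 hw'.1, add_mem hw.2.1 hw'.2.1, by
        simp [hw.2.2, hw'.2.2]⟩
      neg_mem' := fun {w} hw => ⟨neg_mem hw.1, neg_mem hw.2.1, by simp [hw.2.2]⟩ }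
    (fun r w hw => ⟨Submodule.smul_mem _ _ hw.1, Submodule.smul_mem _ _ hw.2.1, by
      simp [hw.2.2]⟩)
    (fun v w hw => ⟨Submodule.smul_mem _ _ hw.1, Submodule.smul_mem _ _ hw.2.1, by
      simp [hw.2.2, otherEnd]⟩)
    (fun α w hw => ⟨Submodule.smul_mem _ _ hw.1, Submodule.smul_mem _ _ hw.2.1, by
      rw [Prod.smul_fst, Prod.smul_snd, arrowElt_smul_apply_self α hw.1,
        arrowElt_smul_apply_self α hw.2.1]⟩)

variable {k φ}

theorem top_mem_projectiveAt [Finite Γ] (x : Γ × Bool) :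
    (single k φ x, single k φ (otherEnd x)) ∈ projectiveAt k φ x :=
  ⟨single_mem_uniserial .refl, single_mem_uniserial .refl, by simp⟩

section Generation

variable [Finite Γ] {x : Γ × Bool}
  {N : Submodule (Q.QuotAlgebra k)ᵐᵒᵖ (EndSpace k φ × EndSpace k φ)}

/-- The arrow at the corner after x kills the basis vector at the other end of the arc. The first
step away from the top therefore already separates the two components. -/
theorem single_fst_mem (hN : (single k φ x, single k φ (otherEnd x)) ∈ N) {y : Γ × Bool}
    (h : S.After x y) (hy : y ≠ x) : (single k φ y, (0 : EndSpace k φ)) ∈ N := by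
  induction h with
  | refl => exact absurd rfl hy
  | @tail b c h hbc ih =>
    by_cases hb : b = x
    · subst hb
      have := N.smul_mem (op (Q.arrowElt k (cornerArrow φ b hbc.1))) hN
      rwa [Prod.smul_mk, arrowElt_smul_single hbc,
        arrowElt_smul_single_of_ne _ (otherEnd_ne b).symm] at this
    · have := N.smul_mem (op (Q.arrowElt k (cornerArrow φ b hbc.1))) (ih hb)
      rwa [Prod.smul_mk, arrowElt_smul_single hbc, smul_zero] at this

theorem single_snd_mem (hN : (single k φ x, single k φ (otherEnd x)) ∈ N) {y : Γ × Bool}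
    (h : S.After (otherEnd x) y) (hy : y ≠ otherEnd x) :
    ((0 : EndSpace k φ), single k φ y) ∈ N := by
  induction h with
  | refl => exact absurd rfl hy
  | @tail b c h hbc ih =>
    by_cases hb : b = otherEnd x
    · subst hb
      have := N.smul_mem (op (Q.arrowElt k (cornerArrow φ _ hbc.1))) hN
      rwa [Prod.smul_mk, arrowElt_smul_single hbc,
        arrowElt_smul_single_of_ne _ (otherEnd_ne x)] at this
    · have := N.smul_mem (op (Q.arrowElt k (cornerArrow φ b hbc.1))) (ih hb)
      rwa [Prod.smul_mk, arrowElt_smul_single hbc, smul_zero] at this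

theorem projectiveAt_le (hN : (single k φ x, single k φ (otherEnd x)) ∈ N) :
    projectiveAt k φ x ≤ N := by
  rintro ⟨a, b⟩ ⟨ha, hb, hab⟩
  dsimp only at ha hb hab
  have h1 : a - a x • single k φ x ∈ N.comap (LinearMap.inl _ _ _) := by
    refine mem_of_single fun y hy => ?_
    rw [EndSpace.sub_apply, smul_single_apply] at hy
    by_cases hyx : y = x
    · simp [hyx] at hy
    · exact single_fst_mem hN (ha y (by simpa [hyx] using hy)) hyx
  have h2 : b - b (otherEnd x) • single k φ (otherEnd x) ∈ N.comap (LinearMap.inr _ _ _) := by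
    refine mem_of_single fun y hy => ?_
    rw [EndSpace.sub_apply, smul_single_apply] at hy
    by_cases hyx : y = otherEnd x
    · simp [hyx] at hy
    · exact single_snd_mem hN (hb y (by simpa [hyx] using hy)) hyx
  have h3 := N.smul_mem (op (algebraMap k (Q.QuotAlgebra k) (a x))) hN
  rw [Prod.smul_mk, scalar_smul, scalar_smul] at h3
  have h4 := add_mem (add_mem h3 h1) h2
  simpa [hab] using h4

end Generation

/-! ### Paths turning around a marked point -/

section Paths

open Classical in
variable (k φ) in
/-- The path that starts with the arc of `x` and turns `n` times counterclockwise around the marked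
point of the end `x`; it is `0` when it meets the boundary. -/
noncomputable def turnPath (x : Γ × Bool) : ℕ → Q.QuotAlgebra k
  | 0 => Q.vertexElt k (φ.vertex.symm x.1)
  | n + 1 => turnPath x n *
      if h : S.IsLast (S.rot^[n] x) then 0 else Q.arrowElt k (cornerArrow φ _ h)

open Classical in
theorem turnPath_mul_vertexElt (x : Γ × Bool) (n : ℕ) (v : V) :
    turnPath k φ x n * Q.vertexElt k v =
      if (S.rot^[n] x).1 = φ.vertex v then turnPath k φ x n else 0 := by
  cases n with
  | zero =>
    split_ifs with h
    · have h' : φ.vertex.symm x.1 = v := φ.vertex.symm_apply_eq.2 h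
      rw [turnPath, h', vertexElt_mul_self]
    · exact vertexElt_mul_of_ne fun h' => h (φ.vertex.symm_apply_eq.1 h')
  | succ n =>
    rw [turnPath, mul_assoc, Function.iterate_succ_apply']
    by_cases hl : S.IsLast (S.rot^[n] x)
    · simp [hl]
    · simp only [hl, dite_false]
      have ht := φ.tgt_arrow (cornerArrow φ _ hl)
      simp only [boundQuiver, arrow_cornerArrow] at ht
      split_ifs with h
      · obtain rfl := φ.vertex.injective (ht.symm.trans h)
        rw [arrowElt_mul_vertexElt_tgt]
      · rw [arrowElt_mul_vertexElt_of_ne, mul_zero]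
        rintro rfl
        exact h ht

-- An arrow leaving the arc just reached sits at one of its two ends. At the end reached, it
-- prolongs the turn; at the opposite end, it forms a relation with the last arrow of the path.
open Classical in
theorem turnPath_succ_mul_arrowElt (x : Γ × Bool) (n : ℕ) (α : E) :
    turnPath k φ x (n + 1) * Q.arrowElt k α =
      if S.rot^[n + 1] x = (φ.arrow α).1 then turnPath k φ x (n + 2) else 0 := by
  split_ifs with h
  · have : ¬ S.IsLast (S.rot^[n + 1] x) := by rw [h]; exact (φ.arrow α).2
    rw [turnPath, turnPath.eq_def k φ x (n + 2)]
    simp only [this, dite_false]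
    have h' : α = cornerArrow φ _ this := by
      apply φ.arrow.injective
      apply Subtype.ext
      rw [arrow_cornerArrow, h]
    rw [← h', turnPath]
  · rw [turnPath, mul_assoc]
    by_cases hl : S.IsLast (S.rot^[n] x)
    · simp [hl]
    · simp only [hl, dite_false]
      rw [Function.iterate_succ_apply'] at h
      by_cases ht : Q.tgt (cornerArrow φ _ hl) = Q.src α
      · rw [arrowElt_mul_arrowElt_of_rel, mul_zero]
        rw [← φ.rel_arrow]
        have h1 := φ.tgt_arrow (cornerArrow φ _ hl)
        have h2 := φ.src_arrow α
        rw [ht, ← h2] at h1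
        simp only [boundQuiver, arrow_cornerArrow] at h1 ⊢
        revert h h1
        generalize S.rot (S.rot^[n] x) = a
        generalize (φ.arrow α).1 = b
        obtain ⟨a, s⟩ := a
        obtain ⟨b, t⟩ := b
        cases s <;> cases t <;> simp [otherEnd] <;> aesop
      · rw [arrowElt_mul_arrowElt_of_ne ht, mul_zero]

-- A trivial path has no last arrow, so it can be prolonged at both ends of the arc, which accounts
-- for the two summands.
open Classical in
theorem turnPath_zero_mul_arrowElt (x : Γ × Bool) (α : E) :
    turnPath k φ x 0 * Q.arrowElt k α =
      (if x = (φ.arrow α).1 then turnPath k φ x 1 else 0) +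
        (if otherEnd x = (φ.arrow α).1 then turnPath k φ (otherEnd x) 1 else 0) := by
  have key : ∀ y : Γ × Bool, y = (φ.arrow α).1 →
      turnPath k φ y 1 = turnPath k φ y 0 * Q.arrowElt k α := by
    intro y hy
    have hl : ¬ S.IsLast y := by rw [hy]; exact (φ.arrow α).2
    have h' : α = cornerArrow φ _ hl := by
      apply φ.arrow.injective
      apply Subtype.ext
      rw [arrow_cornerArrow, hy]
    have hl' : ¬ S.IsLast (S.rot^[0] y) := hl
    rw [turnPath.eq_def k φ y 1]
    simp only [hl', dite_false]
    rw [h']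
    rfl
  by_cases h : x = (φ.arrow α).1
  · have h2 : otherEnd x ≠ (φ.arrow α).1 := by rw [← h]; exact otherEnd_ne x
    rw [if_pos h, if_neg h2, add_zero, key x h]
  · by_cases h2 : otherEnd x = (φ.arrow α).1
    · rw [if_neg h, if_pos h2, zero_add, key _ h2]
      rfl
    · rw [if_neg h, if_neg h2, add_zero, turnPath, vertexElt_mul_arrowElt_of_ne]
      intro h3
      have h4 := φ.src_arrow α
      rw [h3, Equiv.apply_symm_apply] at h4
      simp only [boundQuiver] at h4
      revert h h2 h4
      generalize (φ.arrow α).1 = b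
      obtain ⟨a, s⟩ := x
      obtain ⟨b, t⟩ := b
      cases s <;> cases t <;> simp [otherEnd] <;> aesop

end Paths

end MarkedRibbonSurface

/-! ### Projectivity of `projectiveAt` -/

namespace MarkedRibbonSurface

open BoundQuiver EndSpace
open MulOpposite hiding op_add

variable {Γ P : Type*} {S : MarkedRibbonSurface Γ P} [Finite Γ]
  {V E : Type*} {Q : BoundQuiver V E} {k : Type*} [CommRing k] [Fintype V]
  {φ : Q.Iso S.boundQuiver}

theorem isLast_iterate_depth (x : Γ × Bool) : S.IsLast (S.rot^[S.depth x] x) := by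
  classical exact Nat.find_spec (S.exists_isLast_iterate x)

theorem turnPath_depth_succ (x : Γ × Bool) : turnPath k φ x (S.depth x + 1) = 0 := by
  simp [turnPath, isLast_iterate_depth]

variable (k φ) in
/-- The combination of the non-trivial paths that start with `x` and turn around its marked point,
with coefficients the values of a function at their ends. -/
noncomputable def pathSum (x : Γ × Bool) : EndSpace k φ →+ Q.QuotAlgebra k where
  toFun a := ∑ n ∈ Finset.range (S.depth x), a (S.rot^[n + 1] x) • turnPath k φ x (n + 1)
  map_zero' := Finset.sum_eq_zero fun _ _ => zero_smul k _
  map_add' a b := by simp [add_smul, Finset.sum_add_distrib]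

theorem pathSum_apply (x : Γ × Bool) (a : EndSpace k φ) : pathSum k φ x a =
    ∑ n ∈ Finset.range (S.depth x), a (S.rot^[n + 1] x) • turnPath k φ x (n + 1) := rfl

theorem pathSum_scalar (x : Γ × Bool) (r : k) (a : EndSpace k φ) :
    pathSum k φ x (op (algebraMap k (Q.QuotAlgebra k) r) • a) = r • pathSum k φ x a := by
  simp only [pathSum_apply, scalar_smul_apply, Finset.smul_sum, mul_smul]

theorem pathSum_vertexElt (x : Γ × Bool) (v : V) (a : EndSpace k φ) :
    pathSum k φ x (op (Q.vertexElt k v) • a) = pathSum k φ x a * Q.vertexElt k v := by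
  simp only [pathSum_apply, Finset.sum_mul]
  refine Finset.sum_congr rfl fun n _ => ?_
  rw [vertexElt_smul_apply, smul_mul_assoc, turnPath_mul_vertexElt]
  split_ifs <;> simp

-- Acting by an arrow on the function and multiplying the paths by it yield the same terms with
-- indices shifted by one. The top term vanishes because the path runs past the boundary; the bottom
-- term remains as a correction.
open Classical in
theorem pathSum_arrowElt (x : Γ × Bool) (α : E) (a : EndSpace k φ) :
    pathSum k φ x (op (Q.arrowElt k α) • a) = pathSum k φ x a * Q.arrowElt k α +
      if x = (φ.arrow α).1 then a x • turnPath k φ x 1 else 0 := by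
  let g : ℕ → Q.QuotAlgebra k := fun n =>
    if S.rot^[n] x = (φ.arrow α).1 then a (S.rot^[n] x) • turnPath k φ x (n + 1) else 0
  have h1 : pathSum k φ x (op (Q.arrowElt k α) • a) = ∑ n ∈ Finset.range (S.depth x), g n := by
    rw [pathSum_apply]
    refine Finset.sum_congr rfl fun n _ => ?_
    rw [arrowElt_smul_apply, Function.iterate_succ_apply']
    by_cases h : S.rot^[n] x = (φ.arrow α).1
    · simp [g, h]
    · simp [g, h]
  have h2 : pathSum k φ x a * Q.arrowElt k α = ∑ n ∈ Finset.range (S.depth x), g (n + 1) := by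
    rw [pathSum_apply, Finset.sum_mul]
    refine Finset.sum_congr rfl fun n _ => ?_
    rw [smul_mul_assoc, turnPath_succ_mul_arrowElt]
    by_cases h : S.rot^[n + 1] x = (φ.arrow α).1
    · simp only [g, h, if_true]
    · simp only [g, h, if_false, smul_zero]
  have h3 : g (S.depth x) = 0 := by simp [g, turnPath_depth_succ]
  change _ = _ + g 0
  rw [h1, h2, ← Finset.sum_range_succ', Finset.sum_range_succ, h3, add_zero]

variable (k φ) in
/-- The embedding of `projectiveAt k φ x` into the regular module that sends the generator to a
trivial path. -/
noncomputable def projectiveAtSection (x : Γ × Bool) :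
    projectiveAt k φ x →ₗ[(Q.QuotAlgebra k)ᵐᵒᵖ] (Q.QuotAlgebra k)ᵐᵒᵖ :=
  linearMapOfGenerators
    { toFun (w : projectiveAt k φ x) := op (w.1.1 x • turnPath k φ x 0 + pathSum k φ x w.1.1 +
        pathSum k φ (otherEnd x) w.1.2)
      map_zero' := by
        change op (((0 : EndSpace k φ) x) • turnPath k φ x 0 + pathSum k φ x 0 +
          pathSum k φ (otherEnd x) 0) = 0
        simp
      map_add' w w' := by
        rw [← MulOpposite.op_add]
        congr 1
        simp only [Submodule.coe_add, Prod.fst_add, Prod.snd_add, map_add, EndSpace.add_apply,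
          add_smul]
        abel }
    (fun r w => by
      change op _ = op _ * op _
      rw [← op_mul, ← Algebra.commutes, ← Algebra.smul_def]
      congr 1
      simp only [Submodule.coe_smul, Prod.smul_fst, Prod.smul_snd, pathSum_scalar,
        scalar_smul_apply, smul_add, mul_smul])
    (fun v w => by
      classical
      change op _ = op _ * op _
      rw [← op_mul]
      congr 1
      simp only [Submodule.coe_smul, Prod.smul_fst, Prod.smul_snd, pathSum_vertexElt, add_mul,
        vertexElt_smul_apply, smul_mul_assoc]
      congr 2
      rw [turnPath_mul_vertexElt, Function.iterate_zero_apply]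
      split_ifs <;> simp)
    (fun α w => by
      classical
      change op _ = op _ * op _
      rw [← op_mul]
      congr 1
      -- Equality of the two top coordinates makes the corrections from both path sums add up to the
      -- product of the trivial path term with the arrow.
      have h := w.2.2.2
      simp only [Submodule.coe_smul, Prod.smul_fst, Prod.smul_snd, pathSum_arrowElt, add_mul,
        smul_mul_assoc, turnPath_zero_mul_arrowElt, arrowElt_smul_apply_self α w.2.1,
        zero_smul, smul_add, smul_ite, smul_zero, ← h]
      abel)

theorem isLast_iff_depth_eq_zero (x : Γ × Bool) : S.IsLast x ↔ S.depth x = 0 := by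
  classical
  rw [depth, Nat.find_eq_zero]
  rfl

theorem depth_iterate_add {x : Γ × Bool} {n : ℕ} (hn : n ≤ S.depth x) :
    S.depth (S.rot^[n] x) + n = S.depth x := by
  induction n with
  | zero => rfl
  | succ n ih =>
    have h := ih (by omega)
    have hl : ¬ S.IsLast (S.rot^[n] x) := by rw [isLast_iff_depth_eq_zero]; omega
    have h' := Next.depth_eq ⟨hl, rfl⟩
    rw [Function.iterate_succ_apply']
    omega

theorem pathSum_single (x : Γ × Bool) : pathSum k φ x (single k φ x) = 0 := by
  rw [pathSum_apply]
  refine Finset.sum_eq_zero fun n hn => ?_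
  have h := S.depth_iterate_add (x := x) (n := n + 1) (by rw [Finset.mem_range] at hn; omega)
  rw [single_apply, if_neg, zero_smul]
  intro h'
  rw [h'] at h
  omega

theorem projectiveAtSection_top (x : Γ × Bool) :
    projectiveAtSection k φ x ⟨_, top_mem_projectiveAt x⟩ =
      op (Q.vertexElt k (φ.vertex.symm x.1)) := by
  change op (single k φ x x • turnPath k φ x 0 + pathSum k φ x (single k φ x) +
        pathSum k φ (otherEnd x) (single k φ (otherEnd x))) = _
  rw [pathSum_single, pathSum_single, single_apply, if_pos rfl, one_smul, add_zero, add_zero]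
  rfl

theorem vertexElt_smul_single (x : Γ × Bool) :
    op (Q.vertexElt k (φ.vertex.symm x.1)) • single k φ x = single k φ x := by
  ext y
  rw [vertexElt_smul_apply, Equiv.apply_symm_apply, single_apply]
  split_ifs with h1 h2 h2
  · rfl
  · rfl
  · exact absurd (by rw [h2]) h1
  · rfl

/-- The equalizer is a submodule containing the generator, so `projectiveAt_le` applies. -/
theorem projectiveAt_hom_ext {N : Type*} [AddCommMonoid N] [Module (Q.QuotAlgebra k)ᵐᵒᵖ N]
    {x : Γ × Bool} {f g : projectiveAt k φ x →ₗ[(Q.QuotAlgebra k)ᵐᵒᵖ] N}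
    (h : f ⟨_, top_mem_projectiveAt x⟩ = g ⟨_, top_mem_projectiveAt x⟩) : f = g := by
  have h' : projectiveAt k φ x ≤ (LinearMap.eqLocus f g).map (projectiveAt k φ x).subtype :=
    projectiveAt_le ⟨_, h, rfl⟩
  ext w
  obtain ⟨w', hw', e⟩ := h' w.2
  obtain rfl : w' = w := Subtype.ext e
  exact hw'

/-- The map from the regular module sending 1 to the top is split by `projectiveAtSection`: the
section sends the top to a trivial path, which fixes the top. -/
theorem projective_projectiveAt (x : Γ × Bool) :
    Module.Projective (Q.QuotAlgebra k)ᵐᵒᵖ (projectiveAt k φ x) := by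
  let top : projectiveAt k φ x := ⟨_, top_mem_projectiveAt x⟩
  let π := LinearMap.toSpanSingleton (Q.QuotAlgebra k)ᵐᵒᵖ _ top
  refine Module.Projective.of_split (projectiveAtSection k φ x) π ?_
  refine projectiveAt_hom_ext (f := π ∘ₗ projectiveAtSection k φ x) (g := LinearMap.id) ?_
  rw [LinearMap.comp_apply, projectiveAtSection_top]
  apply Subtype.ext
  exact Prod.ext (vertexElt_smul_single x) (vertexElt_smul_single (otherEnd x))

end MarkedRibbonSurface

/-! ### Projective dimension of the uniserial modules -/

theorem projectiveDimension_eq_of_hasProjectiveDimensionLT {C : Type*} [Category C] [Abelian C]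
    {X : C} {n : ℕ} (h : HasProjectiveDimensionLT X (n + 1)) (h' : ¬ HasProjectiveDimensionLT X n) :
    projectiveDimension X = ((n : ℕ∞) : WithBot ℕ∞) :=
  le_antisymm ((projectiveDimension_le_iff X n).2 h) ((projectiveDimension_ge_iff X n).2 h')

namespace MarkedRibbonSurface

open BoundQuiver EndSpace
open MulOpposite hiding op_add

variable {Γ P : Type u} {S : MarkedRibbonSurface Γ P} [Finite Γ]
  {V E : Type u} {Q : BoundQuiver V E} {k : Type u} [Field k] [Fintype V]
  (φ : Q.Iso S.boundQuiver)

variable (k) in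
/-- The projection of an indecomposable projective module to a maximal uniserial quotient. -/
noncomputable def projectiveAtFst (x : Γ × Bool) :
    projectiveAt k φ x →ₗ[(Q.QuotAlgebra k)ᵐᵒᵖ] uniserial k φ x :=
  (LinearMap.fst _ _ _).restrict fun _ h => h.1

theorem projectiveAtFst_surjective (x : Γ × Bool) :
    Function.Surjective (projectiveAtFst k φ x) := by
  rintro ⟨a, ha⟩
  refine ⟨⟨(a, a x • single k φ (otherEnd x)), ha, ?_, by simp⟩, rfl⟩
  rw [← scalar_smul]
  exact Submodule.smul_mem _ _ (single_mem_uniserial .refl)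

/-- Nothing follows the other end, so the second component is supported there and is determined by
the shared top coordinate. -/
theorem projectiveAtFst_injective {x : Γ × Bool} (hx : S.IsLast (otherEnd x)) :
    Function.Injective (projectiveAtFst k φ x) := by
  rw [injective_iff_map_eq_zero]
  rintro ⟨⟨a, b⟩, ha, hb, hab⟩ h
  obtain rfl : a = 0 := congrArg Subtype.val h
  dsimp only at hb hab
  obtain rfl : b = 0 := by
    ext y
    by_contra hy
    obtain rfl := hx.eq_of_after (hb y hy)
    exact hy hab.symm
  rfl

theorem projective_uniserial {x : Γ × Bool} (hx : S.IsLast (otherEnd x)) :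
    Module.Projective (Q.QuotAlgebra k)ᵐᵒᵖ (uniserial k φ x) :=
  have := projective_projectiveAt (k := k) (φ := φ) x
  .of_equiv (LinearEquiv.ofBijective (projectiveAtFst k φ x)
    ⟨projectiveAtFst_injective φ hx, projectiveAtFst_surjective φ x⟩)

variable (k) in
/-- The inclusion of the second summand of the radical of an indecomposable projective module. -/
noncomputable def projectiveAtInr {x y : Γ × Bool} (h : S.Next (otherEnd x) y) :
    uniserial k φ y →ₗ[(Q.QuotAlgebra k)ᵐᵒᵖ] projectiveAt k φ x :=
  (LinearMap.inr _ (EndSpace k φ) (EndSpace k φ)).restrict fun _ hw =>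
    ⟨zero_mem _, uniserial_le_of_next h hw, (apply_eq_zero_of_next h hw).symm⟩

theorem projectiveAtInr_injective {x y : Γ × Bool} (h : S.Next (otherEnd x) y) :
    Function.Injective (projectiveAtInr k φ h) := fun _ _ e =>
  Subtype.ext (congrArg (fun w => w.1.2) e)

theorem exact_projectiveAtInr {x y : Γ × Bool} (h : S.Next (otherEnd x) y) :
    Function.Exact (projectiveAtInr k φ h) (projectiveAtFst k φ x) := by
  rintro ⟨⟨a, b⟩, ha, hb, hab⟩
  constructor
  · intro h0
    obtain rfl : a = 0 := congrArg Subtype.val h0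
    dsimp only at hb hab
    refine ⟨⟨b, fun z hz => ((hb z hz).eq_or_next h).resolve_left ?_⟩, rfl⟩
    rintro rfl
    exact hz hab.symm
  · rintro ⟨w, hw⟩
    obtain rfl : 0 = a := congrArg (fun w => w.1.1) hw
    rfl

theorem projective_of_projectiveAt (x : Γ × Bool) :
    Projective (ModuleCat.of (Q.QuotAlgebra k)ᵐᵒᵖ (projectiveAt k φ x)) :=
  have := projective_projectiveAt (k := k) (φ := φ) x
  inferInstance

theorem shortExact_projectiveAt {x y : Γ × Bool} (h : S.Next (otherEnd x) y) :
    (ShortComplex.mk (C := ModuleCat.{u} (Q.QuotAlgebra k)ᵐᵒᵖ)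
      (X₁ := .of _ (uniserial k φ y)) (X₂ := .of _ (projectiveAt k φ x))
      (X₃ := .of _ (uniserial k φ x))
      (ModuleCat.ofHom (projectiveAtInr k φ h)) (ModuleCat.ofHom (projectiveAtFst k φ x))
      (ModuleCat.hom_ext (LinearMap.ext
        (exact_projectiveAtInr φ h).apply_apply_eq_zero))).ShortExact :=
  ModuleCat.shortComplex_shortExact _ (exact_projectiveAtInr φ h) (projectiveAtInr_injective φ h)
    (projectiveAtFst_surjective φ x)

/-- A section would lift the top of the uniserial module to an element with coordinate 1 at both
ends of the arc. The arrow at the other end kills the top but not such a lift. -/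
theorem not_projective_uniserial {x : Γ × Bool} (hx : ¬ S.IsLast (otherEnd x)) :
    ¬ Module.Projective (Q.QuotAlgebra k)ᵐᵒᵖ (uniserial k φ x) := by
  intro h
  obtain ⟨s, hs⟩ := Module.projective_lifting_property (projectiveAtFst k φ x) LinearMap.id
    (projectiveAtFst_surjective φ x)
  let t : uniserial k φ x := ⟨single k φ x, single_mem_uniserial .refl⟩
  have h1 : (s t).1.1 = single k φ x := congrArg Subtype.val (LinearMap.congr_fun hs t)
  have h2 := (s t).2.2.2
  rw [h1, single_apply, if_pos rfl] at h2
  let r : (Q.QuotAlgebra k)ᵐᵒᵖ := op (Q.arrowElt k (cornerArrow φ _ hx))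
  have h3 : r • t = 0 := Subtype.ext (arrowElt_smul_single_of_ne hx (otherEnd_ne x))
  have h4 : r • s t = 0 := by rw [← map_smul, h3, map_zero]
  have h5 : (r • (s t).1.2) (S.rot (otherEnd x)) = 0 := by
    rw [← Prod.smul_snd, ← Submodule.coe_smul, h4]
    rfl
  rw [arrowElt_smul_apply, arrow_cornerArrow, if_pos rfl, ← h2] at h5
  exact one_ne_zero h5

variable (S) in
/-- The side that follows `x` in its elementary polygon, if `x` is not the last one. -/
def nextSide (x : Γ × Bool) : Γ × Bool := otherEnd (S.rot x)

instance (x : Γ × Bool) : Nontrivial (uniserial k φ x) := by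
  refine ⟨⟨⟨single k φ x, single_mem_uniserial .refl⟩, 0, fun h => ?_⟩⟩
  have h' : single k φ x x = 0 := by
    rw [show single k φ x = 0 from congrArg Subtype.val h]
    rfl
  simp at h'

/-- The syzygy of the module attached to the side s is the module attached to `S.nextSide s`, so the
induction follows the polygon. In the base case the module is projective and non-zero. -/
theorem hasProjectiveDimensionLT_uniserial {m : ℕ} {s : Γ × Bool}
    (h : ∀ j < m, ¬ S.IsLast (S.nextSide^[j] s)) (hm : S.IsLast (S.nextSide^[m] s)) :
    HasProjectiveDimensionLT
      (ModuleCat.of (Q.QuotAlgebra k)ᵐᵒᵖ (uniserial k φ (otherEnd s))) (m + 1) ∧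
    ¬ HasProjectiveDimensionLT
      (ModuleCat.of (Q.QuotAlgebra k)ᵐᵒᵖ (uniserial k φ (otherEnd s))) m := by
  induction m generalizing s with
  | zero =>
    rw [zero_add, ← projective_iff_hasProjectiveDimensionLT_one, ← IsProjective.iff_projective,
      hasProjectiveDimensionLT_zero_iff_isZero]
    refine ⟨projective_uniserial φ (by rwa [otherEnd_otherEnd]), fun h0 => ?_⟩
    exact not_subsingleton _ (ModuleCat.isZero_iff_subsingleton.1 h0)
  | succ m ih =>
    have hs : S.Next (otherEnd (otherEnd s)) (S.rot s) := by
      rw [otherEnd_otherEnd]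
      exact ⟨h 0 (Nat.succ_pos m), rfl⟩
    have ih' := @ih (S.nextSide s) (fun j hj => h (j + 1) (by omega)) hm
    rw [nextSide, otherEnd_otherEnd] at ih'
    have hP := projective_of_projectiveAt (k := k) φ (otherEnd s)
    have iff := (shortExact_projectiveAt (k := k) φ hs).hasProjectiveDimensionLT_X₃_iff
    refine ⟨(iff m hP).2 ih'.1, ?_⟩
    -- The dimension shift compares the bounds n + 2 and n + 1 only; bound 1, that is projectivity,
    -- has to be refuted directly.
    cases m with
    | zero =>
      rw [zero_add, ← projective_iff_hasProjectiveDimensionLT_one, ← IsProjective.iff_projective]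
      exact not_projective_uniserial φ hs.1
    | succ m => exact fun h => ih'.2 ((iff m hP).1 h)

/-! ### Counting the sides of an elementary polygon -/

section Polygons

variable (S) in
theorem nextSide_injective : Function.Injective S.nextSide := fun x y h => by
  apply S.rot.injective
  rw [← otherEnd_otherEnd (S.rot x), ← otherEnd_otherEnd (S.rot y)]
  exact congrArg otherEnd h

theorem consecutiveSides_iff {x y : Γ × Bool} :
    S.ConsecutiveSides x y ↔ ¬ S.IsLast x ∧ S.nextSide x = y := by
  rw [ConsecutiveSides, Next, nextSide]
  refine and_congr_right fun _ => ⟨fun h => ?_, fun h => ?_⟩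
  · rw [h, otherEnd_otherEnd]
  · rw [← h, otherEnd_otherEnd]

variable {s : Γ × Bool} (hs : ∀ z, ¬ S.Next z (otherEnd s))

-- The hypothesis on s says that the boundary comes just before it, so the chain of sides cannot
-- re-enter at s.
include hs in
theorem nextSide_ne {z : Γ × Bool} (hz : ¬ S.IsLast z) : S.nextSide z ≠ s := fun h =>
  hs z ⟨hz, by rw [← h, nextSide, otherEnd_otherEnd]⟩

-- An injective self-map of a finite set brings s back to itself; if the boundary were never met, s
-- would follow some side of its polygon.
include hs in
theorem exists_isLast_nextSide_iterate : ∃ m, S.IsLast (S.nextSide^[m] s) := by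
  by_contra! h
  obtain ⟨n, hn, h'⟩ := (S.nextSide_injective.mem_periodicPts s)
  obtain ⟨n, rfl⟩ := Nat.exists_eq_succ_of_ne_zero hn.ne'
  rw [Function.IsPeriodicPt, Function.IsFixedPt, Function.iterate_succ_apply'] at h'
  exact nextSide_ne hs (h n) h'

-- The listed sides are closed under consecutiveness in both directions: the final one has no
-- successor and s has no predecessor.
include hs in
theorem sides_polygonAt {m : ℕ} (h : ∀ j < m, ¬ S.IsLast (S.nextSide^[j] s))
    (hm : S.IsLast (S.nextSide^[m] s)) :
    S.sides (S.polygonAt s) = (fun j => S.nextSide^[j] s) '' Set.Iic m := by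
  apply Set.eq_of_subset_of_subset
  · intro x hx
    have hx : Relation.EqvGen S.ConsecutiveSides x s := Quotient.exact hx
    have key : ∀ a b, Relation.EqvGen S.ConsecutiveSides a b →
        (a ∈ (fun j => S.nextSide^[j] s) '' Set.Iic m ↔
          b ∈ (fun j => S.nextSide^[j] s) '' Set.Iic m) := by
      intro a b hab
      induction hab with
      | refl => rfl
      | symm _ _ _ ih => exact ih.symm
      | trans _ _ _ _ _ ih ih' => exact ih.trans ih'
      | rel a b hab =>
        obtain ⟨ha, rfl⟩ := consecutiveSides_iff.1 hab
        constructor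
        · rintro ⟨j, hj, rfl⟩
          refine ⟨j + 1, ?_, Function.iterate_succ_apply' _ _ _⟩
          rcases (Set.mem_Iic.1 hj).lt_or_eq with hj | rfl
          · exact hj
          · exact absurd hm ha
        · rintro ⟨j, hj, hj'⟩
          cases j with
          | zero => exact absurd hj'.symm (nextSide_ne hs ha)
          | succ j =>
            refine ⟨j, Set.mem_Iic.2 ((Nat.le_succ j).trans hj), S.nextSide_injective ?_⟩
            rw [← hj']
            exact (Function.iterate_succ_apply' _ _ _).symm
    exact (key x s hx).2 ⟨0, Nat.zero_le m, rfl⟩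
  · rintro _ ⟨j, hj, rfl⟩
    rw [Set.mem_Iic] at hj
    induction j with
    | zero => rfl
    | succ j ih =>
      refine Eq.trans (Quotient.sound (Relation.EqvGen.symm _ _ (.rel _ _ ?_))) (ih (by omega))
      exact consecutiveSides_iff.2 ⟨h j hj, (Function.iterate_succ_apply' _ _ _).symm⟩

include hs in
theorem consecutiveArcs_polygonAt {m : ℕ} (h : ∀ j < m, ¬ S.IsLast (S.nextSide^[j] s))
    (hm : S.IsLast (S.nextSide^[m] s)) :
    S.consecutiveArcs (S.polygonAt s) = m + 1 := by
  have hsides := sides_polygonAt hs h hm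
  rw [consecutiveArcs, if_pos, hsides, Set.InjOn.encard_image, Set.encard_eq_coe_toFinset_card]
  · simp
  -- By injectivity a repetition among the iterates could be cancelled down to a return to s.
  · have key : ∀ i j, i < j → j ≤ m → S.nextSide^[i] s ≠ S.nextSide^[j] s := by
      intro i j hij hj e
      obtain ⟨d, rfl⟩ := Nat.exists_eq_add_of_lt hij
      rw [add_assoc, Function.iterate_add_apply] at e
      have := (S.nextSide_injective.iterate i e).symm
      rw [Function.iterate_succ_apply'] at this
      exact nextSide_ne hs (h d (by omega)) this
    intro i hi j hj e
    rcases lt_trichotomy i j with hij | hij | hij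
    · exact absurd e (key i j hij hj)
    · exact hij
    · exact absurd e.symm (key j i hij hi)
  · exact ⟨_, hsides ▸ ⟨m, Set.mem_Iic.2 le_rfl, rfl⟩, hm⟩

end Polygons

end MarkedRibbonSurface

/-! ### Injective curves and the two halves of their string modules -/

namespace MarkedRibbonSurface

open BoundQuiver EndSpace
open MulOpposite hiding op_add

namespace PermissibleCurve

variable {Γ P : Type u} {S : MarkedRibbonSurface Γ P} {c : S.PermissibleCurve} {γ : Γ}
  {i : Fin (c.len + 1)} (hc : c.IsInjective γ i)

namespace IsInjective

include hc

theorem next_left {t : Fin c.len} (h : t.val < i.val) :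
    S.Next (c.cross t.castSucc) (c.cross t.succ) := c.step_ccw t (hc.left t h)

theorem next_right {t : Fin c.len} (h : i.val ≤ t.val) :
    S.Next (otherEnd (c.cross t.succ)) (otherEnd (c.cross t.castSucc)) :=
  c.step_cw t (hc.right t h)

/-- Both halves of the string point towards the place of γ, the socle. Up to that place every arrow
goes forward. -/
theorem moves_left {z : Γ × Bool} {s t : Fin (c.len + 1)} (h : c.Moves z s t) (hs : s ≤ i) :
    ∃ u : Fin c.len, u.val < i.val ∧ s = u.castSucc ∧ t = u.succ ∧ z = c.cross s := by
  rcases h with ⟨u, hu, rfl, rfl, rfl⟩ | ⟨u, hu, rfl, rfl, rfl⟩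
  · exact ⟨u, not_le.1 fun h => hc.right u h hu, rfl, rfl, rfl⟩
  · exact absurd (hc.left u hs) hu

theorem moves_right {z : Γ × Bool} {s t : Fin (c.len + 1)} (h : c.Moves z s t) (hs : i ≤ s) :
    ∃ u : Fin c.len, i.val ≤ u.val ∧ s = u.succ ∧ t = u.castSucc ∧ z = otherEnd (c.cross s) := by
  rcases h with ⟨u, hu, rfl, rfl, rfl⟩ | ⟨u, hu, rfl, rfl, rfl⟩
  · exact absurd hu (hc.right u hs)
  · exact ⟨u, not_lt.1 fun h => hu (hc.left u h), rfl, rfl, rfl⟩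

theorem after_left {t : Fin (c.len + 1)} (ht : t ≤ i) : S.After (c.cross 0) (c.cross t) := by
  induction t using Fin.induction with
  | zero => exact .refl
  | succ t ih =>
    exact (ih (Fin.castSucc_lt_succ.le.trans ht)).tail (hc.next_left ht)

theorem after_right {t : Fin (c.len + 1)} (ht : i ≤ t) :
    S.After (otherEnd (c.cross (Fin.last _))) (otherEnd (c.cross t)) := by
  induction t using Fin.reverseInduction with
  | last => exact .refl
  | cast t ih =>
    exact (ih (ht.trans Fin.castSucc_lt_succ.le)).tail (hc.next_right ht)

/-- The curve leaves out no end between `c.cross 0` and γ, so an end from `c.cross 0` on is either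
crossed before γ or lies from γ on. This later identifies the kernel of `presentation`. -/
theorem after_left_cases {y : Γ × Bool} (h : S.After (c.cross 0) y) :
    (∃ t < i, y = c.cross t) ∨ S.After (c.cross i) y := by
  induction h with
  | refl =>
    by_cases hi : i = 0
    · exact .inr (hi ▸ .refl)
    · exact .inl ⟨0, Fin.pos_iff_ne_zero.2 hi, rfl⟩
  | @tail b d _ hbd ih =>
    rcases ih with ⟨t, ht, rfl⟩ | ih
    · have hl : t.val < c.len := lt_of_lt_of_le ht (Nat.lt_succ_iff.1 i.2)
      have hn := hc.next_left (t := ⟨t.val, hl⟩) ht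
      have hd : d = c.cross (Fin.succ ⟨t.val, hl⟩) := hbd.2.symm.trans hn.2
      have hle : Fin.succ ⟨t.val, hl⟩ ≤ i := ht
      rcases hle.lt_or_eq with h | h
      · exact .inl ⟨_, h, hd⟩
      · exact .inr (by rw [hd, h]; exact .refl)
    · exact .inr (ih.tail hbd)

theorem after_right_cases {y : Γ × Bool} (h : S.After (otherEnd (c.cross (Fin.last _))) y) :
    (∃ t, i < t ∧ y = otherEnd (c.cross t)) ∨ S.After (otherEnd (c.cross i)) y := by
  induction h with
  | refl =>
    by_cases hi : i = Fin.last _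
    · exact .inr (hi ▸ .refl)
    · exact .inl ⟨_, Fin.lt_last_iff_ne_last.2 hi, rfl⟩
  | @tail b d _ hbd ih =>
    rcases ih with ⟨t, ht, rfl⟩ | ih
    · obtain ⟨u, rfl⟩ := Fin.exists_succ_eq_of_ne_zero (Fin.ne_zero_of_lt ht)
      have hu : i.val ≤ u.val := Nat.lt_succ_iff.1 ht
      have hd : d = otherEnd (c.cross u.castSucc) := hbd.2.symm.trans (hc.next_right hu).2
      have hle : i ≤ u.castSucc := hu
      rcases hle.lt_or_eq with h | h
      · exact .inl ⟨_, h, hd⟩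
      · exact .inr (by rw [hd, h]; exact .refl)
    · exact .inr (ih.tail hbd)

variable [Finite Γ]

theorem depth_left {t : Fin (c.len + 1)} (ht : t ≤ i) :
    S.depth (c.cross 0) = S.depth (c.cross t) + t.val := by
  induction t using Fin.induction with
  | zero => rfl
  | succ t ih =>
    have h1 := ih (Fin.castSucc_lt_succ.le.trans ht)
    have h2 := (hc.next_left ht).depth_eq
    simp only [Fin.val_castSucc, Fin.val_succ] at h1 ⊢
    omega

theorem depth_right {t : Fin (c.len + 1)} (ht : i ≤ t) :
    S.depth (otherEnd (c.cross (Fin.last _))) + t.val =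
      S.depth (otherEnd (c.cross t)) + c.len := by
  induction t using Fin.reverseInduction with
  | last => rfl
  | cast t ih =>
    have h1 := ih (ht.trans Fin.castSucc_lt_succ.le)
    have h2 := (hc.next_right ht).depth_eq
    simp only [Fin.val_castSucc, Fin.val_succ] at h1 ⊢
    omega

end IsInjective

section Module

variable {V E : Type u} {Q : BoundQuiver V E} {k : Type u} [Field k] [Fintype V]
  (φ : Q.Iso S.boundQuiver)

theorem op_smul_stringModule (a : Q.QuotAlgebra k) (m : Fin (c.len + 1) → k) :
    (op a • (show stringModule φ c from m)) = Matrix.vecMul m (c.stringRep k φ a) := rfl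

theorem stringRep_vertexElt (v : V) :
    c.stringRep k φ (Q.vertexElt k v) = c.genMatrix k φ (.inl v) := by
  rw [stringRep, vertexElt, RingQuot.liftAlgHom_mkAlgHom_apply, idem, FreeAlgebra.lift_ι_apply]

theorem stringRep_arrowElt (α : E) :
    c.stringRep k φ (Q.arrowElt k α) = c.genMatrix k φ (.inr α) := by
  rw [stringRep, arrowElt, RingQuot.liftAlgHom_mkAlgHom_apply, arr, FreeAlgebra.lift_ι_apply]

theorem scalar_smul_stringModule (r : k) (m : Fin (c.len + 1) → k) (t : Fin (c.len + 1)) :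
    Matrix.vecMul m (c.stringRep k φ (algebraMap k _ r)) t = r * m t := by
  rw [AlgHom.commutes, Matrix.algebraMap_eq_diagonal, Matrix.vecMul_diagonal, mul_comm]
  rfl

open Classical in
theorem vertexElt_smul_stringModule (v : V) (m : Fin (c.len + 1) → k) (t : Fin (c.len + 1)) :
    Matrix.vecMul m (c.stringRep k φ (Q.vertexElt k v)) t =
      if (c.cross t).1 = φ.vertex v then m t else 0 := by
  rw [stringRep_vertexElt, genMatrix, Matrix.vecMul_diagonal]
  split_ifs <;> simp

open Classical in
theorem arrowElt_smul_stringModule (α : E) (m : Fin (c.len + 1) → k) (t : Fin (c.len + 1)) :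
    Matrix.vecMul m (c.stringRep k φ (Q.arrowElt k α)) t =
      ∑ s, if c.Moves (φ.arrow α).1 s t then m s else 0 := by
  rw [stringRep_arrowElt, genMatrix, Matrix.vecMul, dotProduct]
  refine Finset.sum_congr rfl fun s _ => ?_
  rw [Matrix.of_apply]
  split_ifs <;> simp

open Classical in
/-- The restriction of a function on the ends to those around `p` that the injective curve
crosses. -/
noncomputable def leftMap : EndSpace k φ →ₗ[(Q.QuotAlgebra k)ᵐᵒᵖ] stringModule (k := k) φ c :=
  linearMapOfGenerators
    { toFun w := (fun t => if t ≤ i then w (c.cross t) else 0 : Fin (c.len + 1) → k)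
      map_zero' := funext fun t => by simp; rfl
      map_add' w w' := funext fun t => by
        change _ = (if t ≤ i then w (c.cross t) else 0) + (if t ≤ i then w' (c.cross t) else 0)
        split_ifs <;> simp }
    (fun r w => funext fun t => by
      refine Eq.trans ?_ (scalar_smul_stringModule φ r _ t).symm
      change (if t ≤ i then _ else _) = r * (if t ≤ i then w (c.cross t) else 0)
      simp)
    (fun v w => funext fun t => by
      refine Eq.trans ?_ (vertexElt_smul_stringModule φ v _ t).symm
      change (if t ≤ i then _ else _) = if _ then (if t ≤ i then w (c.cross t) else 0) else 0
      rw [vertexElt_smul_apply]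
      split_ifs <;> rfl)
    (fun α w => funext fun t => by
      refine Eq.trans ?_ (arrowElt_smul_stringModule φ α _ t).symm
      change (if t ≤ i then _ else _) =
        ∑ s, if c.Moves (φ.arrow α).1 s t then (if s ≤ i then w (c.cross s) else 0) else 0
      rw [arrowElt_smul_apply]
      -- On the left half a place receives a value under α only from the preceding place, so the
      -- matrix sum has at most one non-zero term.
      by_cases h : ∃ u : Fin c.len, u.val < i.val ∧ t = u.succ ∧ (φ.arrow α).1 = c.cross u.castSucc
      · obtain ⟨u, hu, rfl, hz⟩ := h
        rw [Finset.sum_eq_single u.castSucc, if_pos (show u.succ ≤ i from hu), hz,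
          if_pos (hc.next_left hu).2.symm, if_pos (.inl ⟨u, hc.left u hu, rfl, rfl, rfl⟩),
          if_pos (show u.castSucc ≤ i from hu.le)]
        · intro s _ hs
          split_ifs with h1 h2
          · obtain ⟨u', -, h3, h4, -⟩ := hc.moves_left h1 h2
            rw [Fin.succ_injective _ h4] at hs
            exact absurd h3 hs
          · rfl
          · rfl
        · simp
      · rw [Finset.sum_eq_zero]
        · split_ifs with h1 h2
          · exfalso
            cases t using Fin.cases with
            -- An arrow of the end space arriving at `c.cross 0` would come from an earlier end at
            -- p, which maximality of the curve excludes.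
            | zero => exact hc.left_max _ ⟨(φ.arrow α).2, h2.symm⟩
            | succ u =>
              exact h ⟨u, h1, rfl, Next.injective ⟨(φ.arrow α).2, h2.symm⟩ (hc.next_left h1)⟩
          · rfl
          · rfl
        · intro s _
          split_ifs with h1 h2
          · obtain ⟨u, hu, rfl, h4, h5⟩ := hc.moves_left h1 h2
            exact absurd ⟨u, hu, h4, h5⟩ h
          · rfl
          · rfl)

open Classical in
/-- The restriction of a function on the ends to those around `q` that the injective curve
crosses. -/
noncomputable def rightMap : EndSpace k φ →ₗ[(Q.QuotAlgebra k)ᵐᵒᵖ] stringModule (k := k) φ c :=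
  linearMapOfGenerators
    { toFun w := (fun t => if i ≤ t then w (otherEnd (c.cross t)) else 0 : Fin (c.len + 1) → k)
      map_zero' := funext fun t => by simp; rfl
      map_add' w w' := funext fun t => by
        change _ = (if i ≤ t then w (otherEnd (c.cross t)) else 0) +
          (if i ≤ t then w' (otherEnd (c.cross t)) else 0)
        split_ifs <;> simp }
    (fun r w => funext fun t => by
      refine Eq.trans ?_ (scalar_smul_stringModule φ r _ t).symm
      change (if i ≤ t then _ else _) = r * (if i ≤ t then w (otherEnd (c.cross t)) else 0)
      simp)
    (fun v w => funext fun t => by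
      refine Eq.trans ?_ (vertexElt_smul_stringModule φ v _ t).symm
      change (if i ≤ t then _ else _) =
        if _ then (if i ≤ t then w (otherEnd (c.cross t)) else 0) else 0
      rw [vertexElt_smul_apply, otherEnd]
      split_ifs <;> rfl)
    (fun α w => funext fun t => by
      refine Eq.trans ?_ (arrowElt_smul_stringModule φ α _ t).symm
      change (if i ≤ t then _ else _) = ∑ s, if c.Moves (φ.arrow α).1 s t then
        (if i ≤ s then w (otherEnd (c.cross s)) else 0) else 0
      rw [arrowElt_smul_apply]
      by_cases h : ∃ u : Fin c.len, i.val ≤ u.val ∧ t = u.castSucc ∧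
          (φ.arrow α).1 = otherEnd (c.cross u.succ)
      · obtain ⟨u, hu, rfl, hz⟩ := h
        rw [Finset.sum_eq_single u.succ, if_pos (show i ≤ u.castSucc from hu), hz,
          if_pos (hc.next_right hu).2.symm, if_pos (.inr ⟨u, hc.right u hu, rfl, rfl, rfl⟩),
          if_pos (show i ≤ u.succ from Nat.le_succ_of_le hu)]
        · intro s _ hs
          split_ifs with h1 h2
          · obtain ⟨u', -, h3, h4, -⟩ := hc.moves_right h1 h2
            rw [Fin.castSucc_injective _ h4] at hs
            exact absurd h3 hs
          · rfl
          · rfl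
        · simp
      · rw [Finset.sum_eq_zero]
        · split_ifs with h1 h2
          · exfalso
            cases t using Fin.lastCases with
            | last => exact hc.right_max _ ⟨(φ.arrow α).2, h2.symm⟩
            | cast u =>
              exact h ⟨u, h1, rfl, Next.injective ⟨(φ.arrow α).2, h2.symm⟩ (hc.next_right h1)⟩
          · rfl
          · rfl
        · intro s _
          split_ifs with h1 h2
          · obtain ⟨u, hu, rfl, h4, h5⟩ := hc.moves_right h1 h2
            exact absurd ⟨u, hu, h4, h5⟩ h
          · rfl
          · rfl)

end Module

end PermissibleCurve

end MarkedRibbonSurface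

/-! ### The presentation of the injective module -/

namespace MarkedRibbonSurface

open BoundQuiver EndSpace
open MulOpposite hiding op_add

namespace PermissibleCurve

variable {Γ P : Type u} {S : MarkedRibbonSurface Γ P} {c : S.PermissibleCurve} {γ : Γ}
  {i : Fin (c.len + 1)} (hc : c.IsInjective γ i) [Finite Γ]
  {V E : Type u} {Q : BoundQuiver V E} {k : Type u} [Field k] [Fintype V]
  (φ : Q.Iso S.boundQuiver)

open Classical in
theorem leftMap_apply (w : EndSpace k φ) (t : Fin (c.len + 1)) :
    (show Fin (c.len + 1) → k from leftMap hc φ w) t = if t ≤ i then w (c.cross t) else 0 := rfl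

open Classical in
theorem rightMap_apply (w : EndSpace k φ) (t : Fin (c.len + 1)) :
    (show Fin (c.len + 1) → k from rightMap hc φ w) t =
      if i ≤ t then w (otherEnd (c.cross t)) else 0 := rfl

variable (k) in
/-- The module `uniserial k φ γ⁰₁ ⊕ uniserial k φ γ̃⁰₁`. -/
abbrev TwoUniserial (c : S.PermissibleCurve) (φ : Q.Iso S.boundQuiver) : Type u :=
  uniserial k φ (c.cross 0) × uniserial k φ (otherEnd (c.cross (Fin.last _)))

/-- The presentation of the injective module by the two uniserial modules that start with its
tops. -/
noncomputable def presentation :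
    TwoUniserial k c φ →ₗ[(Q.QuotAlgebra k)ᵐᵒᵖ] stringModule (k := k) φ c :=
  (leftMap hc φ ∘ₗ (uniserial k φ _).subtype).coprod
    (-(rightMap hc φ ∘ₗ (uniserial k φ _).subtype))

theorem presentation_apply (w : TwoUniserial k c φ) :
    presentation hc φ w = leftMap hc φ w.1.1 - rightMap hc φ w.2.1 :=
  (sub_eq_add_neg _ _).symm

theorem uniserial_mono {x y : Γ × Bool} (h : S.After x y) : uniserial k φ y ≤ uniserial k φ x :=
  fun _ hw z hz => Relation.ReflTransGen.trans h (hw z hz)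

/-- The embedding of the indecomposable projective module at `γ`, with image the kernel of
`presentation`. -/
noncomputable def kernelMap :
    projectiveAt k φ (c.cross i) →ₗ[(Q.QuotAlgebra k)ᵐᵒᵖ] TwoUniserial k c φ :=
  ((LinearMap.fst _ _ _ ∘ₗ (projectiveAt k φ _).subtype).codRestrict _
    fun w => uniserial_mono φ (hc.after_left le_rfl) w.2.1).prod
  ((LinearMap.snd _ _ _ ∘ₗ (projectiveAt k φ _).subtype).codRestrict _
    fun w => uniserial_mono φ (hc.after_right le_rfl) w.2.2.1)

theorem kernelMap_injective : Function.Injective (kernelMap (k := k) hc φ) := fun _ _ h =>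
  Subtype.ext (Prod.ext (congrArg (fun w : TwoUniserial k c φ => w.1.1) h)
    (congrArg (fun w : TwoUniserial k c φ => w.2.1) h))

/-- Only one half of the string sees a given place other than that of γ, so in the kernel both
functions vanish before γ. At γ itself the two values must agree, which is the gluing condition of
`projectiveAt`. -/
theorem exact_kernelMap_presentation :
    Function.Exact (kernelMap (k := k) hc φ) (presentation hc φ) := by
  rintro ⟨⟨a, ha⟩, ⟨b, hb⟩⟩
  rw [presentation_apply, sub_eq_zero]
  constructor
  · intro h
    have h' : ∀ t, (if t ≤ i then a (c.cross t) else 0) =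
        if i ≤ t then b (otherEnd (c.cross t)) else 0 := fun t => by
      classical
      convert congrFun h t using 1
      · rw [← leftMap_apply hc]
      · rw [← rightMap_apply hc]
    have ha' : a ∈ uniserial k φ (c.cross i) := fun y hy => by
      refine (hc.after_left_cases (ha y hy)).resolve_left ?_
      rintro ⟨t, ht, rfl⟩
      have := h' t
      rw [if_pos ht.le, if_neg ht.not_ge] at this
      exact hy this
    have hb' : b ∈ uniserial k φ (otherEnd (c.cross i)) := fun y hy => by
      refine (hc.after_right_cases (hb y hy)).resolve_left ?_
      rintro ⟨t, ht, rfl⟩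
      have := h' t
      rw [if_pos ht.le, if_neg ht.not_ge] at this
      exact hy this.symm
    refine ⟨⟨(a, b), ha', hb', ?_⟩, rfl⟩
    have := h' i
    rwa [if_pos le_rfl, if_pos le_rfl] at this
  · rintro ⟨⟨⟨a', b'⟩, ha', hb', hab⟩, h⟩
    obtain rfl : a' = a := congrArg (fun w : TwoUniserial k c φ => w.1.1) h
    obtain rfl : b' = b := congrArg (fun w : TwoUniserial k c φ => w.2.1) h
    dsimp only at ha' hb' hab
    refine funext fun t => ?_
    refine (leftMap_apply hc φ a' t).trans (Eq.trans ?_ (rightMap_apply hc φ b' t).symm)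
    rcases lt_trichotomy t i with ht | rfl | ht
    · rw [if_pos ht.le, if_neg ht.not_ge]
      by_contra h0
      -- The support of a' lies from γ on, while an end crossed before γ has strictly larger depth.
      have h1 := (ha' _ h0).depth_le
      have h2 := hc.depth_left ht.le
      have h3 := hc.depth_left le_rfl
      have : t.val < i.val := ht
      omega
    · simpa using hab
    · rw [if_neg ht.not_ge, if_pos ht.le]
      by_contra h0
      have h1 := (hb' _ (Ne.symm h0)).depth_le
      have h2 := hc.depth_right ht.le
      have h3 := hc.depth_right le_rfl
      have : i.val < t.val := ht
      omega

theorem leftMap_single {t : Fin (c.len + 1)} (ht : t ≤ i) :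
    leftMap hc φ (single k φ (c.cross t)) = (Pi.single t 1 : Fin (c.len + 1) → k) := by
  refine funext fun s => (leftMap_apply hc φ _ s).trans ?_
  rw [single_apply, Pi.single_apply]
  by_cases hs : s = t
  · rw [hs, if_pos ht, if_pos rfl, if_pos rfl]
  · rw [if_neg hs]
    split_ifs with h1 h2
    · exfalso
      have h3 := hc.depth_left ht
      have h4 := hc.depth_left h1
      rw [h2] at h4
      exact hs (Fin.ext (by omega))
    · rfl
    · rfl

theorem rightMap_single {t : Fin (c.len + 1)} (ht : i ≤ t) :
    rightMap hc φ (single k φ (otherEnd (c.cross t))) =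
      (Pi.single t 1 : Fin (c.len + 1) → k) := by
  refine funext fun s => (rightMap_apply hc φ _ s).trans ?_
  rw [single_apply, Pi.single_apply]
  by_cases hs : s = t
  · rw [hs, if_pos ht, if_pos rfl, if_pos rfl]
  · rw [if_neg hs]
    split_ifs with h1 h2
    · exfalso
      have h3 := hc.depth_right ht
      have h4 := hc.depth_right h1
      rw [h2] at h4
      exact hs (Fin.ext (by omega))
    · rfl
    · rfl

theorem mem_of_basis_mem {N : Submodule (Q.QuotAlgebra k)ᵐᵒᵖ (stringModule (k := k) φ c)}
    (h : ∀ t, (show stringModule (k := k) φ c from (Pi.single t 1 : Fin (c.len + 1) → k)) ∈ N)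
    (m : Fin (c.len + 1) → k) : (show stringModule (k := k) φ c from m) ∈ N := by
  have key : ∀ F : Finset (Fin (c.len + 1)), (show stringModule (k := k) φ c from
      (∑ t ∈ F, m t • Pi.single t 1 : Fin (c.len + 1) → k)) ∈ N := by
    intro F
    induction F using Finset.induction_on with
    | empty => exact zero_mem N
    | insert t F ht ih =>
      rw [Finset.sum_insert ht]
      refine add_mem (S := Submodule _ (stringModule (k := k) φ c)) ?_ ih
      have := N.smul_mem (op (algebraMap k (Q.QuotAlgebra k) (m t))) (h t)
      have e : Matrix.vecMul (Pi.single t 1) (c.stringRep k φ (algebraMap k _ (m t))) =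
          m t • (Pi.single t 1 : Fin (c.len + 1) → k) :=
        funext fun s => scalar_smul_stringModule φ (m t) _ s
      rw [op_smul_stringModule, e] at this
      exact this
  convert key Finset.univ using 1
  refine funext fun s => ?_
  rw [Finset.sum_apply, Finset.sum_eq_single s]
  · simp
  · intro t _ ht
    simp [ht.symm]
  · simp

theorem presentation_surjective :
    Function.Surjective (presentation (k := k) hc φ) := by
  rw [← LinearMap.range_eq_top, eq_top_iff]
  refine fun m _ => mem_of_basis_mem φ (fun t => ?_) m
  rcases le_total t i with ht | ht
  · refine ⟨(⟨_, single_mem_uniserial (hc.after_left ht)⟩, 0), ?_⟩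
    rw [presentation_apply]
    refine Eq.trans ?_ (leftMap_single hc φ ht)
    exact (congrArg _ (map_zero (rightMap hc φ))).trans (sub_zero _)
  · refine ⟨(0, ⟨-_, neg_mem (single_mem_uniserial (hc.after_right ht))⟩), ?_⟩
    rw [presentation_apply]
    refine Eq.trans ?_ (rightMap_single hc φ ht)
    refine (congrArg₂ _ (map_zero (leftMap hc φ)) (map_neg (rightMap hc φ) _)).trans ?_
    simp

theorem shortExact_presentation :
    (ShortComplex.mk (C := ModuleCat.{u} (Q.QuotAlgebra k)ᵐᵒᵖ)
      (X₁ := .of _ (projectiveAt k φ (c.cross i))) (X₂ := .of _ (TwoUniserial k c φ))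
      (X₃ := .of _ (stringModule (k := k) φ c))
      (ModuleCat.ofHom (kernelMap (k := k) hc φ)) (ModuleCat.ofHom (presentation hc φ))
      (ModuleCat.hom_ext (LinearMap.ext
        (exact_kernelMap_presentation hc φ).apply_apply_eq_zero))).ShortExact :=
  ModuleCat.shortComplex_shortExact _ (exact_kernelMap_presentation hc φ)
    (kernelMap_injective hc φ) (presentation_surjective hc φ)

theorem hasProjectiveDimensionLT_prod_iff {R : Type u} [Ring R] {X Y : Type u} [AddCommGroup X]
    [Module R X] [AddCommGroup Y] [Module R Y] (n : ℕ) :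
    HasProjectiveDimensionLT (ModuleCat.of R (X × Y)) n ↔
      HasProjectiveDimensionLT (ModuleCat.of R X) n ∧
        HasProjectiveDimensionLT (ModuleCat.of R Y) n := by
  constructor
  · intro h
    have rX : Retract (ModuleCat.of R X) (ModuleCat.of R (X × Y)) :=
      ⟨ModuleCat.ofHom (.inl R X Y), ModuleCat.ofHom (.fst R X Y), rfl⟩
    have rY : Retract (ModuleCat.of R Y) (ModuleCat.of R (X × Y)) :=
      ⟨ModuleCat.ofHom (.inr R X Y), ModuleCat.ofHom (.snd R X Y), rfl⟩
    exact ⟨rX.hasProjectiveDimensionLT n, rY.hasProjectiveDimensionLT n⟩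
  · rintro ⟨hX, hY⟩
    exact hasProjectiveDimensionLT_of_iso (ModuleCat.biprodIsoProd (.of R X) (.of R Y)) n

theorem exists_retraction {R : Type*} [Ring R] {X Y Z : Type*} [AddCommGroup X] [Module R X]
    [AddCommGroup Y] [Module R Y] [AddCommGroup Z] [Module R Z] [Module.Projective R Z]
    {f : X →ₗ[R] Y} {g : Y →ₗ[R] Z} (hf : Function.Injective f) (hfg : Function.Exact f g)
    (hg : Function.Surjective g) : ∃ r : Y →ₗ[R] X, r ∘ₗ f = LinearMap.id := by
  obtain ⟨e, he, -⟩ := hfg.splitSurjectiveEquiv hf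
    ⟨_, (Module.projective_lifting_property g LinearMap.id hg).choose_spec⟩
  refine ⟨LinearMap.fst R X Z ∘ₗ e.toLinearMap, LinearMap.ext fun x => ?_⟩
  simp [he]

-- A projective M gives a retraction r onto P(γ). With crossings on both sides of γ, the generator
-- of P(γ) is a sum of two multiples by arrows in the middle term; r sends these to elements with
-- top coordinate 0, whereas the generator has top coordinate 1.
include hc in
theorem eq_zero_or_eq_last_of_projective
    (h : Module.Projective (Q.QuotAlgebra k)ᵐᵒᵖ (stringModule (k := k) φ c)) :
    i = 0 ∨ i = Fin.last c.len := by
  by_contra! hi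
  obtain ⟨r, hr⟩ := exists_retraction (R := (Q.QuotAlgebra k)ᵐᵒᵖ)
    (X := projectiveAt k φ (c.cross i)) (Y := TwoUniserial k c φ)
    (Z := stringModule (k := k) φ c) (kernelMap_injective (k := k) hc φ)
    (exact_kernelMap_presentation hc φ) (presentation_surjective hc φ)
  have zero : ∀ (α : E) (w : TwoUniserial k c φ),
      (r (op (Q.arrowElt k α) • w)).1.1 (c.cross i) = 0 := fun α w => by
    rw [map_smul]
    exact arrowElt_smul_apply_self α (r w).2.1
  -- The steps u and v of the curve are those immediately before and immediately after γ.
  obtain ⟨u, hu⟩ := Fin.exists_succ_eq_of_ne_zero hi.1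
  obtain ⟨v, hv⟩ := Fin.exists_castSucc_eq.2 hi.2
  have h1 := hc.next_left (t := u) (by rw [← hu]; exact Nat.lt_succ_self _)
  have h2 := hc.next_right (t := v) (by rw [← hv]; exact le_rfl)
  rw [hu] at h1
  rw [hv] at h2
  have hui : u.castSucc ≤ i := by rw [← hu]; exact Fin.castSucc_lt_succ.le
  have hvi : i ≤ v.succ := by rw [← hv]; exact Fin.castSucc_lt_succ.le
  let t1 : TwoUniserial k c φ := (⟨_, single_mem_uniserial (hc.after_left hui)⟩, 0)
  let t2 : TwoUniserial k c φ := (0, ⟨_, single_mem_uniserial (hc.after_right hvi)⟩)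
  have h3 : kernelMap hc φ ⟨_, top_mem_projectiveAt _⟩ =
      op (Q.arrowElt k (cornerArrow φ _ h1.1)) • t1 +
      op (Q.arrowElt k (cornerArrow φ _ h2.1)) • t2 := by
    refine Prod.ext (Subtype.ext ?_) (Subtype.ext ?_)
    · refine Eq.trans ?_ (congrArg₂ (· + ·) (arrowElt_smul_single (k := k) (φ := φ) h1).symm
        (smul_zero _).symm)
      exact (add_zero _).symm
    · refine Eq.trans ?_ (congrArg₂ (· + ·) (smul_zero _).symm
        (arrowElt_smul_single (k := k) (φ := φ) h2).symm)
      exact (zero_add _).symm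
  have h4 := LinearMap.congr_fun hr ⟨_, top_mem_projectiveAt _⟩
  rw [LinearMap.comp_apply, h3, map_add] at h4
  have h5 : (r (op (Q.arrowElt k (cornerArrow φ _ h1.1)) • t1)).1.1 (c.cross i) +
      (r (op (Q.arrowElt k (cornerArrow φ _ h2.1)) • t2)).1.1 (c.cross i) =
      single k φ (c.cross i) (c.cross i) := congrArg (fun w => w.1.1 (c.cross i)) h4
  rw [zero, zero, single_apply, if_pos rfl, add_zero] at h5
  exact zero_ne_one h5

end PermissibleCurve

end MarkedRibbonSurface

/-! ### Projective dimension of the injective module -/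

namespace MarkedRibbonSurface

open BoundQuiver EndSpace
open MulOpposite hiding op_add

section

variable {Γ P : Type u} {S : MarkedRibbonSurface Γ P} [Finite Γ]
  {V E : Type u} {Q : BoundQuiver V E} {k : Type u} [Field k] [Fintype V]
  (φ : Q.Iso S.boundQuiver)

variable (k) in
/-- The projection of an indecomposable projective module to the other maximal uniserial
quotient. -/
noncomputable def projectiveAtSnd (x : Γ × Bool) :
    projectiveAt k φ x →ₗ[(Q.QuotAlgebra k)ᵐᵒᵖ] uniserial k φ (otherEnd x) :=
  (LinearMap.snd _ _ _).restrict fun _ h => h.2.1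

theorem projectiveAtSnd_bijective {x : Γ × Bool} (hx : S.IsLast x) :
    Function.Bijective (projectiveAtSnd k φ x) := by
  constructor
  · rw [injective_iff_map_eq_zero]
    rintro ⟨⟨a, b⟩, ha, hb, hab⟩ h
    obtain rfl : b = 0 := congrArg Subtype.val h
    dsimp only at ha hab
    obtain rfl : a = 0 := by
      ext y
      by_contra hy
      obtain rfl := hx.eq_of_after (ha y hy)
      exact hy hab
    rfl
  · rintro ⟨b, hb⟩
    refine ⟨⟨(b (otherEnd x) • single k φ x, b), ?_, hb, by simp⟩, rfl⟩
    rw [← scalar_smul]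
    exact Submodule.smul_mem _ _ (single_mem_uniserial .refl)

end

namespace PermissibleCurve

variable {Γ P : Type u} {S : MarkedRibbonSurface Γ P} {c : S.PermissibleCurve} {γ : Γ}
  {i : Fin (c.len + 1)} (hc : c.IsInjective γ i) [Finite Γ]
  {V E : Type u} {Q : BoundQuiver V E} {k : Type u} [Field k] [Fintype V]
  (φ : Q.Iso S.boundQuiver)

/-- Composing r with the inverse of the bijection gives a left inverse of f, so Z is a direct
summand of Y. Allowing a target X' other than X lets r be a coordinate projection. -/
theorem projective_of_retraction {R : Type*} [Ring R] {X X' Y Z : Type*} [AddCommGroup X]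
    [Module R X] [AddCommGroup X'] [Module R X'] [AddCommGroup Y] [Module R Y] [AddCommGroup Z] [Module R Z] [Module.Projective R Y]
    {f : X →ₗ[R] Y} {g : Y →ₗ[R] Z} (hfg : Function.Exact f g) (hg : Function.Surjective g)
    (r : Y →ₗ[R] X') (hr : Function.Bijective (r ∘ₗ f)) : Module.Projective R Z := by
  let e := LinearEquiv.ofBijective _ hr
  obtain ⟨e', -, he'⟩ := hfg.splitInjectiveEquiv hg ⟨e.symm.toLinearMap ∘ₗ r, LinearMap.ext fun x =>
    e.symm_apply_apply x⟩
  refine Module.Projective.of_split (e'.symm.toLinearMap ∘ₗ LinearMap.inr R X Z) g ?_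
  ext z
  simp [he']

-- Both uniserial modules are projective, and γ is the first or last arc crossed. The projection of
-- the middle term to the summand starting at γ is then bijective on P(γ), so the sequence splits.
include hc in
theorem projective_stringModule (hfirst : S.IsLast c.firstEnd) (hlast : S.IsLast c.lastEnd)
    (hi : i = 0 ∨ i = Fin.last c.len) :
    Module.Projective (Q.QuotAlgebra k)ᵐᵒᵖ (stringModule (k := k) φ c) := by
  have h1 : Module.Projective (Q.QuotAlgebra k)ᵐᵒᵖ (uniserial k φ (c.cross 0)) :=
    projective_uniserial φ hfirst
  have h2 : Module.Projective (Q.QuotAlgebra k)ᵐᵒᵖ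
      (uniserial k φ (otherEnd (c.cross (Fin.last _)))) :=
    projective_uniserial φ (by rwa [otherEnd_otherEnd])
  have h3 : Module.Projective (Q.QuotAlgebra k)ᵐᵒᵖ (TwoUniserial k c φ) := inferInstance
  rcases hi with rfl | rfl
  · exact projective_of_retraction (R := (Q.QuotAlgebra k)ᵐᵒᵖ)
      (X := projectiveAt k φ (c.cross 0)) (Y := TwoUniserial k c φ)
      (Z := stringModule (k := k) φ c) (exact_kernelMap_presentation hc φ)
      (presentation_surjective hc φ) (LinearMap.fst _ _ _)
      ⟨projectiveAtFst_injective φ hfirst, projectiveAtFst_surjective φ _⟩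
  · exact projective_of_retraction (R := (Q.QuotAlgebra k)ᵐᵒᵖ)
      (X := projectiveAt k φ (c.cross (Fin.last _))) (Y := TwoUniserial k c φ)
      (Z := stringModule (k := k) φ c) (exact_kernelMap_presentation hc φ)
      (presentation_surjective hc φ) (LinearMap.snd _ _ _) (projectiveAtSnd_bijective φ hlast)

theorem firstExists_iff : c.FirstExists ↔ ¬ S.IsLast c.firstEnd :=
  ⟨fun ⟨_, h⟩ => h.1, fun h => ⟨_, h, rfl⟩⟩

theorem lastExists_iff : c.LastExists ↔ ¬ S.IsLast c.lastEnd :=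
  ⟨fun ⟨_, h⟩ => h.1, fun h => ⟨_, h, rfl⟩⟩

-- Since P(γ) has dimension less than 1, every bound N ≥ 1 for M passes to the middle term and hence
-- to both uniserial summands. Conversely, their bounds give one for M, the 1 in the maximum being
-- the cost of the kernel P(γ).
include hc in
theorem projectiveDimension_stringModule {m n : ℕ}
    (hm : ∀ j < m, ¬ S.IsLast (S.nextSide^[j] c.firstEnd))
    (hm' : S.IsLast (S.nextSide^[m] c.firstEnd))
    (hn : ∀ j < n, ¬ S.IsLast (S.nextSide^[j] c.lastEnd))
    (hn' : S.IsLast (S.nextSide^[n] c.lastEnd)) :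
    (¬ Projective (stringModule (k := k) φ c) →
      projectiveDimension (stringModule (k := k) φ c) =
        ((max 1 (max m n) : ℕ) : ℕ∞)) ∧
    (Projective (stringModule (k := k) φ c) ↔
      (m = 0 ∧ n = 0) ∧ (i = 0 ∨ i = Fin.last c.len)) := by
  have hT := hasProjectiveDimensionLT_uniserial (k := k) φ hm hm'
  rw [firstEnd, otherEnd_otherEnd] at hT
  have hT' := hasProjectiveDimensionLT_uniserial (k := k) φ hn hn'
  rw [lastEnd] at hT'
  have hS := shortExact_presentation (k := k) hc φ
  have hP := projective_of_projectiveAt (k := k) φ (c.cross i)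
  have hP' (n : ℕ) (hn : 1 ≤ n) := hasProjectiveDimensionLT_of_ge
    (ModuleCat.of (Q.QuotAlgebra k)ᵐᵒᵖ (projectiveAt k φ (c.cross i))) 1 n hn
  have lower (N : ℕ) (hN : 1 ≤ N)
      (h : HasProjectiveDimensionLT (stringModule (k := k) φ c) N) : m < N ∧ n < N := by
    obtain ⟨h1, h2⟩ := (hasProjectiveDimensionLT_prod_iff N).1
      (hS.hasProjectiveDimensionLT_X₂ N (hP' N hN) h)
    constructor
    · by_contra! h3
      exact hT.2 (hasProjectiveDimensionLT_of_ge _ N m h3)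
    · by_contra! h3
      exact hT'.2 (hasProjectiveDimensionLT_of_ge _ N n h3)
  constructor
  · intro hM
    refine projectiveDimension_eq_of_hasProjectiveDimensionLT ?_ fun h => ?_
    · refine hS.hasProjectiveDimensionLT_X₃ _ (hP' _ (le_max_left _ _)) ?_
      refine (hasProjectiveDimensionLT_prod_iff _).2 ⟨?_, ?_⟩
      · have := hT.1
        exact hasProjectiveDimensionLT_of_ge _ (m + 1) _ (by omega)
      · have := hT'.1
        exact hasProjectiveDimensionLT_of_ge _ (n + 1) _ (by omega)
    · have := lower _ (le_max_left _ _) h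
      rw [projective_iff_hasProjectiveDimensionLT_one] at hM
      -- If the maximum is 1, a smaller dimension would make M projective; otherwise it equals m or
      -- n, against `lower`.
      by_cases h1 : max 1 (max m n) = 1
      · exact hM (h1 ▸ h)
      · omega
  · constructor
    · intro h
      have h1 := lower 1 le_rfl (projective_iff_hasProjectiveDimensionLT_one.1 h)
      exact ⟨by omega, eq_zero_or_eq_last_of_projective hc φ
        ((IsProjective.iff_projective _).2 h)⟩
    · rintro ⟨⟨rfl, rfl⟩, hi⟩
      exact (IsProjective.iff_projective (stringModule (k := k) φ c)).1
        (projective_stringModule hc φ hm' hn' hi)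

end PermissibleCurve

end MarkedRibbonSurface

open MarkedRibbonSurface PermissibleCurve in
theorem mainTheorem8 {k V E Γ P : Type u} [Field k] [Fintype V] [Finite Γ]
    (Q : BoundQuiver V E) (hQ : Q.IsGentle)
    (S : MarkedRibbonSurface Γ P) (φ : Q.Iso S.boundQuiver)
    (γ : Γ) (c : S.PermissibleCurve) (i : Fin (c.len + 1)) (hc : c.IsInjective γ i)
    (M : ModuleCat.{u} (Q.QuotAlgebra k)ᵐᵒᵖ)
    (hM : M = MarkedRibbonSurface.PermissibleCurve.stringModule φ c) :
    (¬ Projective M → projectiveDimension M =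
      ((max 1 (max (S.consecutiveArcs c.firstPolygon - 1)
        (S.consecutiveArcs c.lastPolygon - 1)) : ℕ∞) : WithBot ℕ∞)) ∧
    (c.FirstExists ∧ c.LastExists → projectiveDimension M =
      ((max (S.consecutiveArcs c.firstPolygon) (S.consecutiveArcs c.lastPolygon) - 1 : ℕ∞) :
        WithBot ℕ∞)) ∧
    (¬ Projective M → ¬ c.FirstExists ∧ ¬ c.LastExists → projectiveDimension M = 1) ∧
    (Projective M ↔
      (¬ c.FirstExists ∧ ¬ c.LastExists) ∧ (i = 0 ∨ i = Fin.last c.len)) := by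
  classical
  subst hM
  have hfirst : ∀ z, ¬ S.Next z (otherEnd c.firstEnd) := by
    rw [firstEnd, otherEnd_otherEnd]
    exact hc.left_max
  have hlast : ∀ z, ¬ S.Next z (otherEnd c.lastEnd) := hc.right_max
  -- Here m, and n below, count the steps from the starting side of the polygon to its last side. So
  -- ℭ is m + 1, respectively n + 1, and the next arc exists exactly when the count is positive.
  obtain ⟨m, hm, hm'⟩ : ∃ m, (∀ j < m, ¬ S.IsLast (S.nextSide^[j] c.firstEnd)) ∧
      S.IsLast (S.nextSide^[m] c.firstEnd) :=
    have h := exists_isLast_nextSide_iterate hfirst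
    ⟨Nat.find h, fun _ => Nat.find_min h, Nat.find_spec h⟩
  obtain ⟨n, hn, hn'⟩ : ∃ n, (∀ j < n, ¬ S.IsLast (S.nextSide^[j] c.lastEnd)) ∧
      S.IsLast (S.nextSide^[n] c.lastEnd) :=
    have h := exists_isLast_nextSide_iterate hlast
    ⟨Nat.find h, fun _ => Nat.find_min h, Nat.find_spec h⟩
  have first_iff : ¬ c.FirstExists ↔ m = 0 := by
    rw [firstExists_iff, not_not]
    exact ⟨fun h => by by_contra h0; exact hm 0 (Nat.pos_of_ne_zero h0) h, fun h => by
      subst h; exact hm'⟩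
  have last_iff : ¬ c.LastExists ↔ n = 0 := by
    rw [lastExists_iff, not_not]
    exact ⟨fun h => by by_contra h0; exact hn 0 (Nat.pos_of_ne_zero h0) h, fun h => by
      subst h; exact hn'⟩
  obtain ⟨hdim, hproj⟩ := projectiveDimension_stringModule (k := k) hc φ hm hm' hn hn'
  rw [firstPolygon, lastPolygon, consecutiveArcs_polygonAt hfirst hm hm',
    consecutiveArcs_polygonAt hlast hn hn', first_iff, last_iff]
  have hsub : ∀ a : ℕ, (a + 1 : ℕ∞) - 1 = a := fun a =>
    by
    rw [← Nat.cast_one, ← Nat.cast_add, ← ENat.natCast_sub, Nat.add_sub_cancel]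
  refine ⟨fun h => ?_, fun ⟨h1, h2⟩ => ?_, fun h hmn => ?_, hproj⟩
  · rw [hdim h, hsub, hsub]
    push_cast
    rfl
  -- With m and n positive, M is not projective and the 1 in the maximum is redundant.
  · have hm0 : m ≠ 0 := fun h => first_iff.2 h h1
    have hn0 : n ≠ 0 := fun h => last_iff.2 h h2
    have h : max ((m : ℕ∞) + 1) (n + 1) - 1 = ((max (m + 1) (n + 1) - 1 : ℕ) : ℕ∞) := by
      push_cast
      rfl
    rw [hdim fun h => hm0 (hproj.1 h).1.1, h]
    congr 2
    omega
  · rw [hdim h, hmn.1, hmn.2]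
    rfl
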